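/- Let $F$ be a number field with ring of integers $\mathcal O_F$, adele ring $\mathbb A$ and class group $C$, let $n\ge 1$, and let $\mathbb F$ be a field. For an idele $a$ write $(a)$ for its fractional ideal. Let $K\subseteq \mathrm{GL}_n(\mathbb A)$ be an open subgroup and $\Delta\subseteq \mathrm{GL}_n(\mathbb A)$ a submonoid containing $K$ such that $K$ and $\delta K\delta^{-1}$ are commensurable for all $\delta\in\Delta$ (a Hecke pair). Let $R(K,\Delta)$ be the $\mathbb Z$-algebra of finite $\mathbb Z$-linear combinations of double cosets $K\delta K$, $\delta\in\Delta$, viewed as the right $K$-invariant finite combinations $\sum a_jK\delta_j$ of cosets, with product $(\sum a_jK\delta_j)(\sum b_iK\epsilon_i)=\sum a_jb_iK\delta_j\epsilon_i$; assume that $R(K,\Delta)$ is commutative. Let $\Delta^{(1)}=\{\delta\in\Delta : (\det\delta)\text{ is principal}\}$, so that $R(K,\Delta^{(1)})\subseteq R(K,\Delta)$. Assume that $(\det\kappa)$ is principal for every $\kappa\in K$. For every $c\in C$ fix $\alpha_c\in \mathrm{GL}_n(\mathbb A)$ with $(\det\alpha_c)\in c$, and assume that $\det\colon \bigcup_{c\in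 C}\alpha_c\,\mathrm{GL}_n(F)\,K\to \mathrm{GL}_1(\mathbb A)$ is surjective. Set $\Gamma_c=\alpha_c^{-1}K\alpha_c\cap \mathrm{GL}_n(F)$ and $\Delta_{c,c'}=\alpha_c^{-1}\Delta\alpha_{c'}\cap \mathrm{GL}_n(F)$. Let $V$ be an $\mathbb F$-vector space with a linear right action of a submonoid of $\mathrm{GL}_n(F)$ that contains all the sets $\Delta_{c,c'}$, and let $i\ge 0$. For groups $\Gamma=\Gamma_c$, $\Gamma'=\Gamma_{c'}$, a right $\Gamma'$-invariant finite combination $\sum a_j\Gamma\delta_j$ with distinct cosets and $\delta_j\in\Delta_{c,c'}$ induces $H^i(\Gamma,V)\to H^i(\Gamma',V)$, sending the class of a homogeneous cocycle $f$ to that of $f'(\gamma_0,\dots,\gamma_i)=\sum_j a_j f(t_j(\gamma_0),\dots,t_j(\gamma_i))\delta_j$, where $t_j(\gamma)\in\Gamma$ is determined by $t_j(\gamma)\delta_r=\delta_j\gamma$ for some $r$. An element $T=\sum a_jK\delta_j\in R(K,\Delta)$ acts on $\bigoplus_{c\in C}H^i(\Gamma_c,V)$ as follows: its component $H^i(\Gamma_c,V)\to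 H^i(\Gamma_{c'},V)$ is the operator induced by $\sum_j a_j\,(\alpha_c^{-1}K\delta_j\alpha_{c'}\cap\Delta_{c,c'})$, each intersection being empty (and contributing $0$) or a single coset of $\Gamma_c$. Elements of $R(K,\Delta^{(1)})$ thereby act on each $H^i(\Gamma_c,V)$. A ring homomorphism $\Phi\colon R\to\mathbb F$ is said to occur in one of these spaces if the space contains $f\neq0$ with $f|T=\Phi(T)f$ for all $T\in R$. Let $\Psi\colon R(K,\Delta)\to\mathbb F$ be a ring homomorphism and $c'\in C$. If the restriction of $\Psi$ to $R(K,\Delta^{(1)})$ occurs in $H^i(\Gamma_{c'},V)$, then $\Psi$ occurs in $\bigoplus_{c\in C}H^i(\Gamma_c,V)$. -/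

import Mathlib

open IsDedekindDomain NumberField
open scoped nonZeroDivisors MatrixGroups

noncomputable section

namespace AdelicHecke

/-! ### Double coset modules `R(Γ, Γ', D)` -/

section DoubleCosets

variable {G : Type*} [Group G]

/-- The set `Γ \ G` of cosets `Γ g`. -/
abbrev Cosets (Γ : Subgroup G) : Type _ := Quotient (QuotientGroup.rightRel Γ)

/-- The coset `Γ g`. -/
def coset (Γ : Subgroup G) (g : G) : Cosets Γ := Quotient.mk _ g

theorem coset_eq_iff {Γ : Subgroup G} {g h : G} : coset Γ g = coset Γ h ↔ h * g⁻¹ ∈ Γ := by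
  rw [coset, coset, Quotient.eq, QuotientGroup.rightRel_apply]

theorem coset_out {Γ : Subgroup G} (x : Cosets Γ) : coset Γ x.out = x := Quotient.out_eq x

/-- Right translation `Γ x ↦ Γ x g` on `Γ \ G`. -/
def mulRight (Γ : Subgroup G) (g : G) : Cosets Γ → Cosets Γ :=
  Quotient.map (fun x => x * g) (fun a b hab => by
    have h : b * a⁻¹ ∈ Γ := QuotientGroup.rightRel_apply.1 hab
    refine QuotientGroup.rightRel_apply.2 ?_
    simpa [mul_assoc] using h)

@[simp] theorem mulRight_coset (Γ : Subgroup G) (g x : G) :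
    mulRight Γ g (coset Γ x) = coset Γ (x * g) := rfl

theorem mulRight_mul (Γ : Subgroup G) (g h : G) (x : Cosets Γ) :
    mulRight Γ h (mulRight Γ g x) = mulRight Γ (g * h) x := by
  rw [← coset_out x]
  simp [mul_assoc]

theorem mulRight_one (Γ : Subgroup G) (x : Cosets Γ) : mulRight Γ 1 x = x := by
  rw [← coset_out x]
  simp

theorem mulRight_injective (Γ : Subgroup G) (g : G) : Function.Injective (mulRight Γ g) := by
  intro x y h
  have := congrArg (mulRight Γ g⁻¹) h
  simpa [mulRight_mul, mulRight_one] using this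

/-- Right translation `∑ aⱼ Γ δⱼ ↦ ∑ aⱼ Γ δⱼ g` on `ℤ[Γ \ G]`. -/
def translate (Γ : Subgroup G) (g : G) : (Cosets Γ →₀ ℤ) →+ (Cosets Γ →₀ ℤ) :=
  Finsupp.mapDomain.addMonoidHom (mulRight Γ g)

theorem translate_mul (Γ : Subgroup G) (g h : G) (φ : Cosets Γ →₀ ℤ) :
    translate Γ h (translate Γ g φ) = translate Γ (g * h) φ := by
  simp only [translate, Finsupp.mapDomain.addMonoidHom_apply]
  rw [← Finsupp.mapDomain_comp]
  congr 1
  funext x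
  exact mulRight_mul Γ g h x

theorem translate_one (Γ : Subgroup G) (φ : Cosets Γ →₀ ℤ) : translate Γ 1 φ = φ := by
  simp only [translate, Finsupp.mapDomain.addMonoidHom_apply]
  have : mulRight Γ (1 : G) = id := funext (mulRight_one Γ)
  rw [this, Finsupp.mapDomain_id]

theorem translate_single (Γ : Subgroup G) (g x : G) (a : ℤ) :
    translate Γ g (Finsupp.single (coset Γ x) a) = Finsupp.single (coset Γ (x * g)) a := by
  simp [translate, Finsupp.mapDomain_single]

theorem translate_apply_mulRight (Γ : Subgroup G) (g : G) (φ : Cosets Γ →₀ ℤ) (x : Cosets Γ) :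
    translate Γ g φ (mulRight Γ g x) = φ x :=
  Finsupp.mapDomain_apply (mulRight_injective Γ g) φ x

/-- `R(Γ, Γ', D)`: the finite `ℤ`-linear combinations `∑ aⱼ Γ δⱼ` of cosets with `δⱼ ∈ D` which
are invariant under right multiplication by `Γ'`. Here `D` is any subset of `G`; the notion is
used when `Γ D Γ' = D`, and it is then the module of finite `ℤ`-linear combinations of double cosets
`Γ δ Γ'`, `δ ∈ D`, each of which is a finite union of cosets `Γ δⱼ`. -/
def heckeModule (Γ Γ' : Subgroup G) (D : Set G) : AddSubgroup (Cosets Γ →₀ ℤ) where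
  carrier := {φ | (∀ γ ∈ Γ', translate Γ γ φ = φ) ∧ ∀ x, φ x ≠ 0 → ∃ δ ∈ D, x = coset Γ δ}
  zero_mem' := ⟨fun γ _ => map_zero _, fun x hx => absurd rfl hx⟩
  add_mem' := by
    rintro φ ψ ⟨h1, h2⟩ ⟨h3, h4⟩
    refine ⟨fun γ hγ => by rw [map_add, h1 γ hγ, h3 γ hγ], fun x hx => ?_⟩
    by_cases h : φ x = 0
    · refine h4 x fun h' => hx ?_
      rw [Finsupp.add_apply, h, h', add_zero]
    · exact h2 x h
  neg_mem' := by
    rintro φ ⟨h1, h2⟩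
    refine ⟨fun γ hγ => by rw [map_neg, h1 γ hγ], fun x hx => h2 x fun h' => hx ?_⟩
    rw [Finsupp.neg_apply, h', neg_zero]

/-- For a right `Γ'`-invariant `φ = ∑ aⱼ Γ δⱼ`, the map `Γ' g ↦ ∑ aⱼ Γ δⱼ g`. -/
def transport {Γ Γ' : Subgroup G} {D : Set G} (φ : heckeModule Γ Γ' D) :
    Cosets Γ' → (Cosets Γ →₀ ℤ) :=
  Quotient.lift (fun g => translate Γ g (φ : Cosets Γ →₀ ℤ)) (fun a b hab => by
    have h : b * a⁻¹ ∈ Γ' := QuotientGroup.rightRel_apply.1 hab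
    have h2 := φ.2.1 _ h
    have h3 : translate Γ a (translate Γ (b * a⁻¹) (φ : Cosets Γ →₀ ℤ))
        = translate Γ a (φ : Cosets Γ →₀ ℤ) := by rw [h2]
    rw [translate_mul] at h3
    simpa using h3.symm)

theorem transport_coset {Γ Γ' : Subgroup G} {D : Set G} (φ : heckeModule Γ Γ' D) (g : G) :
    transport φ (coset Γ' g) = translate Γ g (φ : Cosets Γ →₀ ℤ) := rfl

/-- The composition `(∑ aⱼ Γ δⱼ, ∑ a'ᵢ Γ' δ'ᵢ) ↦ ∑ aⱼ a'ᵢ Γ δⱼ δ'ᵢ`, additive in the second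
variable. -/
def compose {Γ Γ' : Subgroup G} {D : Set G} (φ : heckeModule Γ Γ' D) :
    (Cosets Γ' →₀ ℤ) →+ (Cosets Γ →₀ ℤ) :=
  Finsupp.liftAddHom fun x => zmultiplesHom _ (transport φ x)

theorem compose_single {Γ Γ' : Subgroup G} {D : Set G} (φ : heckeModule Γ Γ' D) (g : G) (a : ℤ) :
    compose φ (Finsupp.single (coset Γ' g) a) = a • translate Γ g (φ : Cosets Γ →₀ ℤ) := by
  simp [compose, transport_coset]

theorem compose_translate {Γ Γ' : Subgroup G} {D : Set G} (φ : heckeModule Γ Γ' D) (g : G)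
    (ψ : Cosets Γ' →₀ ℤ) : compose φ (translate Γ' g ψ) = translate Γ g (compose φ ψ) := by
  have : (compose φ).comp (translate Γ' g) = (translate Γ g).comp (compose φ) := by
    refine Finsupp.addHom_ext fun x a => ?_
    rw [← coset_out x]
    simp only [AddMonoidHom.comp_apply, translate_single, compose_single, map_zsmul,
      translate_mul]
  exact DFunLike.congr_fun this ψ

theorem compose_mem {Γ Γ' Γ'' : Subgroup G} {D D' D'' : Set G} (φ : heckeModule Γ Γ' D)
    (ψ : heckeModule Γ' Γ'' D') (h : ∀ δ ∈ D, ∀ δ' ∈ D', δ * δ' ∈ D'') :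
    compose φ (ψ : Cosets Γ' →₀ ℤ) ∈ heckeModule Γ Γ'' D'' := by
  refine ⟨fun γ hγ => by rw [← compose_translate, ψ.2.1 γ hγ], fun x hx => ?_⟩
  rw [compose, Finsupp.liftAddHom_apply, Finsupp.sum, Finsupp.finsetSum_apply] at hx
  obtain ⟨y, hy, hne⟩ := Finset.exists_ne_zero_of_sum_ne_zero hx
  obtain ⟨δ', hδ', rfl⟩ := ψ.2.2 y (Finsupp.mem_support_iff.1 hy)
  have hne' : translate Γ δ' (φ : Cosets Γ →₀ ℤ) x ≠ 0 := by
    intro h0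
    apply hne
    rw [zmultiplesHom_apply, transport_coset, Finsupp.smul_apply, h0, smul_zero]
  have hx' : x = mulRight Γ δ' (mulRight Γ δ'⁻¹ x) := by
    rw [mulRight_mul, inv_mul_cancel, mulRight_one]
  rw [hx', translate_apply_mulRight] at hne'
  obtain ⟨δ, hδ, hxδ⟩ := φ.2.2 _ hne'
  exact ⟨δ * δ', h δ hδ δ' hδ', by rw [hx', hxδ, mulRight_coset]⟩

/-- The double coset algebra `R(K, Δ) = R(K, K, Δ)` of a Hecke pair `(K, Δ)`. -/
def HeckeAlgebra (K : Subgroup G) (Δ : Submonoid G) : Type _ := heckeModule K K (Δ : Set G)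

namespace HeckeAlgebra

variable {K : Subgroup G} {Δ : Submonoid G}

instance : AddCommGroup (HeckeAlgebra K Δ) :=
  inferInstanceAs (AddCommGroup (heckeModule K K (Δ : Set G)))

/-- The underlying combination of cosets. -/
def val : HeckeAlgebra K Δ →+ (Cosets K →₀ ℤ) := (heckeModule K K (Δ : Set G)).subtype

theorem val_injective : Function.Injective (val (K := K) (Δ := Δ)) := Subtype.val_injective

theorem val_translate (T : HeckeAlgebra K Δ) {k : G} (hk : k ∈ K) :
    translate K k (val T) = val T := T.2.1 k hk

theorem exists_of_val_ne_zero (T : HeckeAlgebra K Δ) {x : Cosets K} (hx : val T x ≠ 0) :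
    ∃ δ ∈ Δ, x = coset K δ := T.2.2 x hx

instance : One (HeckeAlgebra K Δ) :=
  ⟨⟨Finsupp.single (coset K 1) 1, fun k hk => by
      rw [translate_single, one_mul]
      congr 1
      exact coset_eq_iff.2 (by simpa using hk),
    fun x hx => ⟨1, Δ.one_mem, by
      by_contra h
      exact hx (Finsupp.single_eq_of_ne h)⟩⟩⟩

instance : Mul (HeckeAlgebra K Δ) :=
  ⟨fun S T => ⟨compose S T.1, compose_mem S T fun _ h _ h' => Δ.mul_mem h h'⟩⟩

theorem val_one : val (1 : HeckeAlgebra K Δ) = Finsupp.single (coset K 1) 1 := rfl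

theorem val_mul (S T : HeckeAlgebra K Δ) : val (S * T) = compose S (val T) := rfl

theorem compose_single' (S : HeckeAlgebra K Δ) (g : G) (a : ℤ) :
    compose S (Finsupp.single (coset K g) a) = a • translate K g (val S) := compose_single S g a

theorem compose_translate' (S : HeckeAlgebra K Δ) (g : G) (ψ : Cosets K →₀ ℤ) :
    compose S (translate K g ψ) = translate K g (compose S ψ) := compose_translate S g ψ

theorem compose_add_left (S T : HeckeAlgebra K Δ) :
    compose (S + T : HeckeAlgebra K Δ) = compose S + compose T := by
  refine Finsupp.addHom_ext fun x a => ?_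
  rw [← coset_out x, AddMonoidHom.add_apply, compose_single', compose_single', compose_single',
    map_add, map_add, smul_add]

theorem compose_zero_left : compose (0 : HeckeAlgebra K Δ) = 0 := by
  refine Finsupp.addHom_ext fun x a => ?_
  rw [← coset_out x, compose_single', map_zero, map_zero, smul_zero, AddMonoidHom.zero_apply]

theorem compose_mul (S T : HeckeAlgebra K Δ) :
    compose (S * T : HeckeAlgebra K Δ) = (compose S).comp (compose T) := by
  refine Finsupp.addHom_ext fun x a => ?_
  rw [← coset_out x, AddMonoidHom.comp_apply, compose_single', compose_single', val_mul,
    map_zsmul, compose_translate']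

instance : Ring (HeckeAlgebra K Δ) where
  __ := (inferInstance : AddCommGroup (HeckeAlgebra K Δ))
  mul_assoc S T U := val_injective (by
    rw [val_mul, val_mul, val_mul, compose_mul, AddMonoidHom.comp_apply])
  one_mul T := val_injective (by
    rw [val_mul]
    have : compose (1 : HeckeAlgebra K Δ) = AddMonoidHom.id _ := by
      refine Finsupp.addHom_ext fun x a => ?_
      rw [← coset_out x, compose_single', val_one, translate_single, one_mul, Finsupp.smul_single,
        smul_eq_mul, mul_one, AddMonoidHom.id_apply]
    rw [this, AddMonoidHom.id_apply])
  mul_one T := val_injective (by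
    rw [val_mul, val_one, compose_single', translate_one, one_smul])
  left_distrib S T U := val_injective (by
    rw [map_add, val_mul, val_mul, val_mul, map_add, map_add])
  right_distrib S T U := val_injective (by
    rw [map_add, val_mul, val_mul, val_mul, compose_add_left, AddMonoidHom.add_apply])
  zero_mul T := val_injective (by
    rw [val_mul, compose_zero_left, AddMonoidHom.zero_apply, map_zero])
  mul_zero T := val_injective (by rw [val_mul, map_zero, map_zero])
  zsmul := (inferInstance : AddCommGroup (HeckeAlgebra K Δ)).zsmul
  zsmul_zero' := (inferInstance : AddCommGroup (HeckeAlgebra K Δ)).zsmul_zero'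
  zsmul_succ' := (inferInstance : AddCommGroup (HeckeAlgebra K Δ)).zsmul_succ'
  zsmul_neg' := (inferInstance : AddCommGroup (HeckeAlgebra K Δ)).zsmul_neg'

/-- For submonoids `Δ₁ ≤ Δ`, the algebra `R(K, Δ₁)` as a subalgebra of `R(K, Δ)`. -/
def inclusion {Δ₁ : Submonoid G} (h : Δ₁ ≤ Δ) : HeckeAlgebra K Δ₁ →+* HeckeAlgebra K Δ where
  toFun T := ⟨T.1, T.2.1, fun x hx => by
    obtain ⟨δ, hδ, hx⟩ := T.2.2 x hx
    exact ⟨δ, h hδ, hx⟩⟩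
  map_one' := rfl
  map_mul' S T := val_injective rfl
  map_zero' := rfl
  map_add' _ _ := rfl

end HeckeAlgebra

end DoubleCosets

/-! ### Group cohomology by homogeneous cochains, for right modules -/

section Cohomology

variable {𝔽 : Type*} [Field 𝔽] {V : Type*} [AddCommGroup V] [Module 𝔽 V]
  {Γ : Type*} [Group Γ]

/-- The homogeneous `i`-cochains of `Γ` with values in the right module `V`: functions
`f : Γ^(i+1) → V` with `f (γ γ₀, …, γ γᵢ) = f (γ₀, …, γᵢ) γ⁻¹`. A right action is a homomorphism
`ρ` to the opposite of the endomorphism ring, `v γ = (ρ γ).unop v`. -/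
def homCochains (ρ : Γ →* (Module.End 𝔽 V)ᵐᵒᵖ) (i : ℕ) :
    Submodule 𝔽 ((Fin (i + 1) → Γ) → V) where
  carrier := {f | ∀ (γ : Γ) (x : Fin (i + 1) → Γ),
    f (fun k => γ * x k) = (ρ γ⁻¹).unop (f x)}
  zero_mem' := fun γ x => by simp
  add_mem' := fun hf hg γ x => by simp only [Pi.add_apply, hf γ x, hg γ x, map_add]
  smul_mem' := fun a f hf γ x => by simp only [Pi.smul_apply, hf γ x, map_smul]

/-- The coboundary
`(d f) (γ₀, …, γᵢ₊₁) = ∑ⱼ (-1)^j f (γ₀, …, γⱼ₋₁, γⱼ₊₁, …, γᵢ₊₁)`. -/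
def coboundary (𝔽 : Type*) [Field 𝔽] (V : Type*) [AddCommGroup V] [Module 𝔽 V]
    (Γ : Type*) (i : ℕ) :
    ((Fin (i + 1) → Γ) → V) →ₗ[𝔽] ((Fin (i + 2) → Γ) → V) where
  toFun f x := ∑ j : Fin (i + 2), (-1 : 𝔽) ^ (j : ℕ) • f (fun k => x (j.succAbove k))
  map_add' f g := by
    funext x
    simp [smul_add, Finset.sum_add_distrib]
  map_smul' a f := by
    funext x
    simp only [Pi.smul_apply, Finset.smul_sum, RingHom.id_apply]
    exact Finset.sum_congr rfl fun j _ => smul_comm _ _ _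

/-- The homogeneous `i`-cocycles. -/
def cocycles (ρ : Γ →* (Module.End 𝔽 V)ᵐᵒᵖ) (i : ℕ) : Submodule 𝔽 ((Fin (i + 1) → Γ) → V) :=
  homCochains ρ i ⊓ LinearMap.ker (coboundary 𝔽 V Γ i)

/-- The homogeneous `i`-coboundaries. -/
def coboundaries (ρ : Γ →* (Module.End 𝔽 V)ᵐᵒᵖ) :
    (i : ℕ) → Submodule 𝔽 ((Fin (i + 1) → Γ) → V)
  | 0 => ⊥
  | i + 1 => (homCochains ρ i).map (coboundary 𝔽 V Γ i)

/-- The cohomology group `H^i(Γ, V)`. -/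
abbrev Cohomology (ρ : Γ →* (Module.End 𝔽 V)ᵐᵒᵖ) (i : ℕ) : Type _ :=
  cocycles ρ i ⧸ (coboundaries ρ i).submoduleOf (cocycles ρ i)

end Cohomology

/-! ### The action of `R(Γ, Γ', D)` on cohomology -/

section HeckeOperators

variable {𝔽 : Type*} [Field 𝔽] {V : Type*} [AddCommGroup V] [Module 𝔽 V]
  {G : Type*} [Group G] {S : Submonoid G}

/-- The right action of a subgroup `Γ ≤ S` on a right `S`-module. -/
def restrictAction (ρ : S →* (Module.End 𝔽 V)ᵐᵒᵖ) (Γ : Subgroup G) (hΓ : Γ.toSubmonoid ≤ S) :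
    Γ →* (Module.End 𝔽 V)ᵐᵒᵖ :=
  ρ.comp (Submonoid.inclusion hΓ)

open Classical in
/-- The right action `v ↦ v g` of `g ∈ S` (only used for `g ∈ S`). -/
def act (ρ : S →* (Module.End 𝔽 V)ᵐᵒᵖ) (g : G) : Module.End 𝔽 V :=
  if h : g ∈ S then (ρ ⟨g, h⟩).unop else 0

theorem act_of_mem (ρ : S →* (Module.End 𝔽 V)ᵐᵒᵖ) {g : G} (h : g ∈ S) :
    act ρ g = (ρ ⟨g, h⟩).unop := dif_pos h

theorem act_mul (ρ : S →* (Module.End 𝔽 V)ᵐᵒᵖ) {g h : G} (hg : g ∈ S) (hh : h ∈ S) (v : V) :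
    act ρ (g * h) v = act ρ h (act ρ g v) := by
  rw [act_of_mem ρ hg, act_of_mem ρ hh, act_of_mem ρ (S.mul_mem hg hh)]
  have : (⟨g * h, S.mul_mem hg hh⟩ : S) = ⟨g, hg⟩ * ⟨h, hh⟩ := rfl
  rw [this, map_mul]
  rfl

theorem restrictAction_apply (ρ : S →* (Module.End 𝔽 V)ᵐᵒᵖ) {Γ : Subgroup G}
    (hΓ : Γ.toSubmonoid ≤ S) (γ : Γ) : (restrictAction ρ Γ hΓ γ).unop = act ρ (γ : G) := by
  rw [act_of_mem ρ (hΓ γ.2)]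
  rfl

/-- With `δₓ` the chosen representative of a coset `x = Γ δₓ`, the element `tₓ(g) ∈ Γ` determined by
`tₓ(g) δ_y = δₓ g`, where `y = x g`. -/
def cosetCocycle (Γ : Subgroup G) (x : Cosets Γ) (g : G) : Γ :=
  ⟨x.out * g * (mulRight Γ g x).out⁻¹, by
    apply coset_eq_iff.1
    rw [coset_out, ← mulRight_coset, coset_out]⟩

theorem cosetCocycle_mul (Γ : Subgroup G) (x : Cosets Γ) (g h : G) :
    cosetCocycle Γ x (g * h) = cosetCocycle Γ x g * cosetCocycle Γ (mulRight Γ g x) h := by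
  apply Subtype.ext
  simp only [cosetCocycle, Subgroup.coe_mul, mulRight_mul]
  group

/-- On cochains, `T = ∑ aⱼ Γ δⱼ ∈ R(Γ, Γ', D)` sends `f` to
`f' (γ₀, …, γᵢ) = ∑ⱼ aⱼ f (tⱼ(γ₀), …, tⱼ(γᵢ)) δⱼ`. -/
def heckeCochain (ρ : S →* (Module.End 𝔽 V)ᵐᵒᵖ) {Γ : Subgroup G} (Γ' : Subgroup G)
    (T : Cosets Γ →₀ ℤ) (i : ℕ) :
    ((Fin (i + 1) → Γ) → V) →ₗ[𝔽] ((Fin (i + 1) → Γ') → V) where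
  toFun f y := T.sum fun x a => a • act ρ x.out (f fun k => cosetCocycle Γ x (y k : G))
  map_add' f g := by
    funext y
    simp [Finsupp.sum, Finset.sum_add_distrib]
  map_smul' a f := by
    funext y
    simp only [Finsupp.sum, Pi.smul_apply, map_smul, RingHom.id_apply, Finset.smul_sum]
    exact Finset.sum_congr rfl fun x _ => smul_comm _ _ _

theorem heckeCochain_coboundary (ρ : S →* (Module.End 𝔽 V)ᵐᵒᵖ) {Γ : Subgroup G} (Γ' : Subgroup G)
    (T : Cosets Γ →₀ ℤ) (i : ℕ) (f : (Fin (i + 1) → Γ) → V) :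
    heckeCochain ρ Γ' T (i + 1) (coboundary 𝔽 V Γ i f)
      = coboundary 𝔽 V Γ' i (heckeCochain ρ Γ' T i f) := by
  funext y
  simp only [heckeCochain, coboundary, LinearMap.coe_mk, AddHom.coe_mk, Finsupp.sum, map_sum,
    map_smul, Finset.smul_sum]
  rw [Finset.sum_comm]
  exact Finset.sum_congr rfl fun j _ => Finset.sum_congr rfl fun x _ => smul_comm _ _ _

theorem out_mem {Γ Γ' : Subgroup G} {D : Set G} (hΓ : Γ.toSubmonoid ≤ S) (hD : D ⊆ S)
    (T : heckeModule Γ Γ' D) {x : Cosets Γ} (hx : x ∈ (T : Cosets Γ →₀ ℤ).support) :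
    x.out ∈ S := by
  obtain ⟨δ, hδ, h⟩ := T.2.2 x (Finsupp.mem_support_iff.1 hx)
  rw [← coset_out x] at h
  have h1 := coset_eq_iff.1 h.symm
  have h2 : x.out = x.out * δ⁻¹ * δ := by group
  rw [h2]
  exact S.mul_mem (hΓ h1) (hD hδ)

theorem heckeCochain_mem (ρ : S →* (Module.End 𝔽 V)ᵐᵒᵖ) {Γ Γ' : Subgroup G} {D : Set G}
    (hΓ : Γ.toSubmonoid ≤ S) (hΓ' : Γ'.toSubmonoid ≤ S) (hD : D ⊆ S) (T : heckeModule Γ Γ' D)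
    (i : ℕ) {f : (Fin (i + 1) → Γ) → V} (hf : f ∈ homCochains (restrictAction ρ Γ hΓ) i) :
    heckeCochain ρ Γ' (T : Cosets Γ →₀ ℤ) i f ∈ homCochains (restrictAction ρ Γ' hΓ') i := by
  intro γ y
  rw [restrictAction_apply]
  simp only [heckeCochain, LinearMap.coe_mk, AddHom.coe_mk]
  have key : ∀ x ∈ (T : Cosets Γ →₀ ℤ).support,
      act ρ x.out (f fun k => cosetCocycle Γ x ((γ * y k : Γ') : G))
        = act ρ ((γ⁻¹ : Γ') : G) (act ρ (mulRight Γ (γ : G) x).out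
            (f fun k => cosetCocycle Γ (mulRight Γ (γ : G) x) (y k : G))) := by
    intro x hx
    have hx' : mulRight Γ (γ : G) x ∈ (T : Cosets Γ →₀ ℤ).support := by
      rw [Finsupp.mem_support_iff] at hx ⊢
      rw [← T.2.1 γ γ.2, translate_apply_mulRight]
      exact hx
    have h1 : (fun k => cosetCocycle Γ x ((γ * y k : Γ') : G)) = fun k =>
        cosetCocycle Γ x (γ : G) * cosetCocycle Γ (mulRight Γ (γ : G) x) (y k : G) := by
      funext k
      rw [Subgroup.coe_mul, cosetCocycle_mul]
    rw [h1, hf, restrictAction_apply, ← act_mul ρ (hΓ (Subtype.property _)) (out_mem hΓ hD T hx),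
      ← act_mul ρ (out_mem hΓ hD T hx') (hΓ' (Subtype.property _))]
    congr 2
    simp only [cosetCocycle, Subgroup.coe_inv]
    group
  rw [Finsupp.sum, Finset.sum_congr rfl fun x hx => by rw [key x hx], Finsupp.sum, map_sum]
  refine Finset.sum_bij (fun x _ => mulRight Γ (γ : G) x) ?_ ?_ ?_ ?_
  · intro x hx
    rw [Finsupp.mem_support_iff] at hx ⊢
    rw [← T.2.1 γ γ.2, translate_apply_mulRight]
    exact hx
  · intro x _ x' _ h
    exact mulRight_injective Γ _ h
  · intro x hx
    have hx' : mulRight Γ (γ : G) (mulRight Γ (γ : G)⁻¹ x) = x := by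
      rw [mulRight_mul, inv_mul_cancel, mulRight_one]
    refine ⟨mulRight Γ (γ : G)⁻¹ x, ?_, hx'⟩
    rw [Finsupp.mem_support_iff] at hx ⊢
    rw [← hx', ← T.2.1 γ γ.2, translate_apply_mulRight] at hx
    exact hx
  · intro x _
    have h : (T : Cosets Γ →₀ ℤ) (mulRight Γ (γ : G) x) = (T : Cosets Γ →₀ ℤ) x := by
      conv_lhs => rw [← T.2.1 γ γ.2]
      exact translate_apply_mulRight _ _ _ _
    rw [h, map_zsmul]

/-- The operator on cocycles given by `T ∈ R(Γ, Γ', D)`. -/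
def heckeCocycle (ρ : S →* (Module.End 𝔽 V)ᵐᵒᵖ) {Γ Γ' : Subgroup G} {D : Set G}
    (hΓ : Γ.toSubmonoid ≤ S) (hΓ' : Γ'.toSubmonoid ≤ S) (hD : D ⊆ S) (T : heckeModule Γ Γ' D)
    (i : ℕ) : cocycles (restrictAction ρ Γ hΓ) i →ₗ[𝔽] cocycles (restrictAction ρ Γ' hΓ') i :=
  (heckeCochain ρ Γ' (T : Cosets Γ →₀ ℤ) i).restrict fun f hf =>
    ⟨heckeCochain_mem ρ hΓ hΓ' hD T i hf.1, by
      have h : coboundary 𝔽 V Γ i f = 0 := hf.2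
      rw [SetLike.mem_coe, LinearMap.mem_ker, ← heckeCochain_coboundary, h, map_zero]⟩

/-- The operator `f ↦ f | T`, `H^i(Γ, V) → H^i(Γ', V)`, given by `T ∈ R(Γ, Γ', D)`. -/
def heckeOperator (ρ : S →* (Module.End 𝔽 V)ᵐᵒᵖ) {Γ Γ' : Subgroup G} {D : Set G}
    (hΓ : Γ.toSubmonoid ≤ S) (hΓ' : Γ'.toSubmonoid ≤ S) (hD : D ⊆ S) (T : heckeModule Γ Γ' D)
    (i : ℕ) :
    Cohomology (restrictAction ρ Γ hΓ) i →ₗ[𝔽] Cohomology (restrictAction ρ Γ' hΓ') i :=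
  Submodule.mapQ _ _ (heckeCocycle ρ hΓ hΓ' hD T i) (by
    rintro ⟨f, hf⟩ hfb
    rw [Submodule.mem_comap, Submodule.submoduleOf, Submodule.mem_comap]
    rw [Submodule.submoduleOf, Submodule.mem_comap] at hfb
    change heckeCochain ρ Γ' (T : Cosets Γ →₀ ℤ) i f ∈ coboundaries (restrictAction ρ Γ' hΓ') i
    change f ∈ coboundaries (restrictAction ρ Γ hΓ) i at hfb
    cases i with
    | zero =>
      have h : f = 0 := hfb
      rw [h, map_zero]
      exact Submodule.zero_mem _
    | succ i =>
      obtain ⟨e, he, rfl⟩ := hfb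
      exact ⟨_, heckeCochain_mem ρ hΓ hΓ' hD T i he,
        (heckeCochain_coboundary ρ Γ' _ i e).symm⟩)

end HeckeOperators

/-! ### Ideals and ideal classes of ideles -/

section Ideles

variable (F : Type*) [Field F] [NumberField F]

/-- The exponent `ord_v (a_v)` of the prime `v` in the fractional ideal of the idele `a`. -/
def ideleOrd (v : HeightOneSpectrum (𝓞 F)) (a : (AdeleRing (𝓞 F) F)ˣ) : ℤ :=
  -WithZero.log (Valued.v ((a : AdeleRing (𝓞 F) F).2 v))

/-- A nonzero prime of `𝓞 F` as an invertible fractional ideal. -/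
def primeUnit (v : HeightOneSpectrum (𝓞 F)) : (FractionalIdeal (𝓞 F)⁰ F)ˣ :=
  Units.mk0 (v.asIdeal : FractionalIdeal (𝓞 F)⁰ F) (FractionalIdeal.coeIdeal_ne_zero.2 v.ne_bot)

theorem idele_apply_ne_zero (v : HeightOneSpectrum (𝓞 F)) (a : (AdeleRing (𝓞 F) F)ˣ) :
    (a : AdeleRing (𝓞 F) F).2 v ≠ 0 := by
  intro h
  have h1 : ((a : AdeleRing (𝓞 F) F) * ((a⁻¹ : (AdeleRing (𝓞 F) F)ˣ) : AdeleRing (𝓞 F) F)).2 v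
      = 1 := by
    rw [Units.mul_inv]
    rfl
  have h2 : ((a : AdeleRing (𝓞 F) F) * ((a⁻¹ : (AdeleRing (𝓞 F) F)ˣ) : AdeleRing (𝓞 F) F)).2 v
      = (a : AdeleRing (𝓞 F) F).2 v * ((a⁻¹ : (AdeleRing (𝓞 F) F)ˣ) : AdeleRing (𝓞 F) F).2 v := rfl
  rw [h1, h, zero_mul] at h2
  exact one_ne_zero h2

theorem ideleOrd_mul (v : HeightOneSpectrum (𝓞 F)) (a b : (AdeleRing (𝓞 F) F)ˣ) :
    ideleOrd F v (a * b) = ideleOrd F v a + ideleOrd F v b := by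
  have h : ((a * b : (AdeleRing (𝓞 F) F)ˣ) : AdeleRing (𝓞 F) F).2 v
      = (a : AdeleRing (𝓞 F) F).2 v * (b : AdeleRing (𝓞 F) F).2 v := rfl
  rw [ideleOrd, ideleOrd, ideleOrd, h, map_mul, WithZero.log_mul, neg_add]
  · exact (Valuation.ne_zero_iff _).2 (idele_apply_ne_zero F v a)
  · exact (Valuation.ne_zero_iff _).2 (idele_apply_ne_zero F v b)

theorem finite_ideleOrd (a : (AdeleRing (𝓞 F) F)ˣ) :
    (Function.mulSupport fun v => primeUnit F v ^ ideleOrd F v a).Finite := by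
  have hu : IsUnit (a : AdeleRing (𝓞 F) F).2 :=
    ⟨⟨(a : AdeleRing (𝓞 F) F).2, ((a⁻¹ : (AdeleRing (𝓞 F) F)ˣ) : AdeleRing (𝓞 F) F).2,
      congrArg Prod.snd a.mul_inv, congrArg Prod.snd a.inv_mul⟩, rfl⟩
  refine Set.Finite.subset (FiniteAdeleRing.isUnit_iff.1 hu).2 fun v hv hv' => hv ?_
  have h : Valued.v ((a : AdeleRing (𝓞 F) F).2 v) = 1 := hv'
  simp only [ideleOrd, h, WithZero.log_one, neg_zero, zpow_zero]

/-- The fractional ideal `(a) = ∏_v v ^ ord_v (a_v)` of an idele `a`. -/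
def ideleIdeal : (AdeleRing (𝓞 F) F)ˣ →* (FractionalIdeal (𝓞 F)⁰ F)ˣ :=
  MonoidHom.mk' (fun a => ∏ᶠ v, primeUnit F v ^ ideleOrd F v a) fun a b => by
    rw [← finprod_mul_distrib (finite_ideleOrd F a) (finite_ideleOrd F b)]
    exact finprod_congr fun v => by rw [ideleOrd_mul, zpow_add]

/-- The class of `(a)` in the class group. -/
def ideleClass : (AdeleRing (𝓞 F) F)ˣ →* ClassGroup (𝓞 F) :=
  (ClassGroup.mk F).comp (ideleIdeal F)

end Ideles

/-! ### Adelic Hecke pairs and their action on `⨁_c H^i(Γ_c, V)` -/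

section Adelic

variable {F : Type*} [Field F] [NumberField F] {n : ℕ}

/-- The embedding `GL_n(F) → GL_n(𝔸)`. -/
def diagonal (F : Type*) [Field F] [NumberField F] (n : ℕ) :
    GL (Fin n) F →* GL (Fin n) (AdeleRing (𝓞 F) F) :=
  Matrix.GeneralLinearGroup.map (algebraMap F (AdeleRing (𝓞 F) F))

/-- The class of the ideal `(det g)`, for `g ∈ GL_n(𝔸)`. -/
def detClass (F : Type*) [Field F] [NumberField F] (n : ℕ) :
    GL (Fin n) (AdeleRing (𝓞 F) F) →* ClassGroup (𝓞 F) :=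
  (ideleClass F).comp Matrix.GeneralLinearGroup.det

/-- `Δ^{(1)} = {δ ∈ Δ | (det δ) is principal}`. -/
def principalPart (Δ : Submonoid (GL (Fin n) (AdeleRing (𝓞 F) F))) :
    Submonoid (GL (Fin n) (AdeleRing (𝓞 F) F)) :=
  Δ ⊓ MonoidHom.mker (detClass F n)

/-- `Γ = a⁻¹ K a ∩ GL_n(F)`. -/
def arithGroup (K : Subgroup (GL (Fin n) (AdeleRing (𝓞 F) F)))
    (a : GL (Fin n) (AdeleRing (𝓞 F) F)) : Subgroup (GL (Fin n) F) :=
  K.comap ((MulAut.conj a).toMonoidHom.comp (diagonal F n))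

theorem mem_arithGroup {K : Subgroup (GL (Fin n) (AdeleRing (𝓞 F) F))}
    {a : GL (Fin n) (AdeleRing (𝓞 F) F)} {g : GL (Fin n) F} :
    g ∈ arithGroup K a ↔ a * diagonal F n g * a⁻¹ ∈ K := Iff.rfl

/-- `a⁻¹ Δ b ∩ GL_n(F)`. -/
def arithSet (Δ : Submonoid (GL (Fin n) (AdeleRing (𝓞 F) F)))
    (a b : GL (Fin n) (AdeleRing (𝓞 F) F)) : Set (GL (Fin n) F) :=
  {g | a * diagonal F n g * b⁻¹ ∈ Δ}

theorem arithGroup_le {K : Subgroup (GL (Fin n) (AdeleRing (𝓞 F) F))}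
    {Δ : Submonoid (GL (Fin n) (AdeleRing (𝓞 F) F))} (hK : K.toSubmonoid ≤ Δ)
    {a : GL (Fin n) (AdeleRing (𝓞 F) F)} {S : Submonoid (GL (Fin n) F)}
    (hS : arithSet Δ a a ⊆ S) : (arithGroup K a).toSubmonoid ≤ S :=
  fun _ hg => hS (hK (mem_arithGroup.1 hg))

/-- The map `Γ d ↦ K a d b⁻¹`, where `Γ = a⁻¹ K a ∩ GL_n(F)`. -/
def cosetMap (K : Subgroup (GL (Fin n) (AdeleRing (𝓞 F) F)))
    (a b : GL (Fin n) (AdeleRing (𝓞 F) F)) : Cosets (arithGroup K a) → Cosets K :=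
  Quotient.map (fun d => a * diagonal F n d * b⁻¹) (fun d e hde => by
    have h := mem_arithGroup.1 (QuotientGroup.rightRel_apply.1 hde)
    refine QuotientGroup.rightRel_apply.2 ?_
    simpa [mul_assoc] using h)

@[simp] theorem cosetMap_coset (K : Subgroup (GL (Fin n) (AdeleRing (𝓞 F) F)))
    (a b : GL (Fin n) (AdeleRing (𝓞 F) F)) (d : GL (Fin n) F) :
    cosetMap K a b (coset _ d) = coset K (a * diagonal F n d * b⁻¹) := rfl

theorem cosetMap_injective (K : Subgroup (GL (Fin n) (AdeleRing (𝓞 F) F)))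
    (a b : GL (Fin n) (AdeleRing (𝓞 F) F)) : Function.Injective (cosetMap K a b) := by
  intro x y h
  rw [← coset_out x, ← coset_out y, cosetMap_coset, cosetMap_coset, coset_eq_iff] at h
  rw [← coset_out x, ← coset_out y, coset_eq_iff, mem_arithGroup]
  simpa [mul_assoc] using h

theorem cosetMap_mulRight (K : Subgroup (GL (Fin n) (AdeleRing (𝓞 F) F)))
    (a b : GL (Fin n) (AdeleRing (𝓞 F) F)) (g : GL (Fin n) F) (x : Cosets (arithGroup K a)) :
    cosetMap K a b (mulRight _ g x) = mulRight K (b * diagonal F n g * b⁻¹) (cosetMap K a b x) := by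
  rw [← coset_out x, mulRight_coset, cosetMap_coset, cosetMap_coset, mulRight_coset]
  congr 1
  rw [map_mul]
  group

/-- The map `R(K, Δ) → R(Γ, Γ', D)` with `Γ = a⁻¹ K a ∩ GL_n(F)`, `Γ' = b⁻¹ K b ∩ GL_n(F)` and
`D = a⁻¹ Δ b ∩ GL_n(F)`, given by `∑ aⱼ K δⱼ ↦ ∑ aⱼ (a⁻¹ K δⱼ b ∩ D)`, where `a⁻¹ K δⱼ b ∩ D` is
either empty (and then contributes `0`) or a single coset of `Γ`. -/
def localize {K : Subgroup (GL (Fin n) (AdeleRing (𝓞 F) F))}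
    {Δ : Submonoid (GL (Fin n) (AdeleRing (𝓞 F) F))} (hK : K.toSubmonoid ≤ Δ)
    (a b : GL (Fin n) (AdeleRing (𝓞 F) F)) (T : HeckeAlgebra K Δ) :
    heckeModule (arithGroup K a) (arithGroup K b) (arithSet Δ a b) :=
  ⟨Finsupp.comapDomain (cosetMap K a b) (HeckeAlgebra.val T) (cosetMap_injective K a b).injOn, by
    refine ⟨fun γ hγ => ?_, fun x hx => ?_⟩
    · ext y
      have hy : y = mulRight _ γ (mulRight _ γ⁻¹ y) := by
        rw [mulRight_mul, inv_mul_cancel, mulRight_one]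
      rw [hy, translate_apply_mulRight, Finsupp.comapDomain_apply, Finsupp.comapDomain_apply,
        cosetMap_mulRight K a b γ]
      conv_rhs => rw [← T.val_translate (mem_arithGroup.1 hγ)]
      exact (translate_apply_mulRight _ _ _ _).symm
    · rw [Finsupp.comapDomain_apply] at hx
      obtain ⟨δ, hδ, h⟩ := T.exists_of_val_ne_zero hx
      refine ⟨x.out, ?_, (coset_out x).symm⟩
      rw [← coset_out x, cosetMap_coset] at h
      have h1 := coset_eq_iff.1 h.symm
      have h2 : a * diagonal F n x.out * b⁻¹ = a * diagonal F n x.out * b⁻¹ * δ⁻¹ * δ := by group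
      change a * diagonal F n x.out * b⁻¹ ∈ Δ
      rw [h2]
      exact Δ.mul_mem (hK h1) hδ⟩

variable {𝔽 : Type*} [Field 𝔽] {V : Type*} [AddCommGroup V] [Module 𝔽 V]
  (K : Subgroup (GL (Fin n) (AdeleRing (𝓞 F) F)))
  (Δ : Submonoid (GL (Fin n) (AdeleRing (𝓞 F) F))) [hKΔ : IsHeckeTriple Δ K K]
  (α : ClassGroup (𝓞 F) → GL (Fin n) (AdeleRing (𝓞 F) F))
  {S : Submonoid (GL (Fin n) F)} (hS : ∀ c c', arithSet Δ (α c) (α c') ⊆ S)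
  (ρ : S →* (Module.End 𝔽 V)ᵐᵒᵖ) (i : ℕ)

/-- `H^i(Γ_c, V)` with `Γ_c = α_c⁻¹ K α_c ∩ GL_n(F)`, for a right module `V` of a semigroup `S`
containing all the sets `Δ_{c,c'} = α_c⁻¹ Δ α_{c'} ∩ GL_n(F)`. -/
abbrev CohomologyAt (c : ClassGroup (𝓞 F)) : Type _ :=
  Cohomology (restrictAction ρ (arithGroup K (α c)) (arithGroup_le hKΔ.left_le (hS c c))) i

/-- The direct sum `⨁_c H^i(Γ_c, V)`; as the class group is finite, it is the product. -/
abbrev TotalCohomology : Type _ := ∀ c, CohomologyAt K Δ α hS ρ i c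

/-- The operator `H^i(Γ_c, V) → H^i(Γ_{c'}, V)` given by `T ∈ R(K, Δ)` through
`R(K, Δ) → R(Γ_c, Γ_{c'}, Δ_{c,c'})`. -/
def componentOperator (c c' : ClassGroup (𝓞 F)) (T : HeckeAlgebra K Δ) :
    CohomologyAt K Δ α hS ρ i c →ₗ[𝔽] CohomologyAt K Δ α hS ρ i c' :=
  heckeOperator ρ (arithGroup_le hKΔ.left_le (hS c c)) (arithGroup_le hKΔ.left_le (hS c' c'))
    (hS c c') (localize hKΔ.left_le (α c) (α c') T) i

/-- The action `f ↦ f | T` of `T ∈ R(K, Δ)` on `⨁_c H^i(Γ_c, V)`: the component of `f | T` at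
`c'` is the sum over `c` of the images of `f_c` under `H^i(Γ_c, V) → H^i(Γ_{c'}, V)`. -/
def adelicOperator (T : HeckeAlgebra K Δ) :
    TotalCohomology K Δ α hS ρ i →ₗ[𝔽] TotalCohomology K Δ α hS ρ i :=
  LinearMap.pi fun c' => ∑ c, componentOperator K Δ α hS ρ i c c' T ∘ₗ LinearMap.proj c

/-- The action of `R(K, Δ^{(1)})` on `H^i(Γ_c, V)`. -/
def principalOperator (c : ClassGroup (𝓞 F)) (T : HeckeAlgebra K (principalPart Δ)) :
    CohomologyAt K Δ α hS ρ i c →ₗ[𝔽] CohomologyAt K Δ α hS ρ i c :=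
  componentOperator K Δ α hS ρ i c c (HeckeAlgebra.inclusion inf_le_left T)

end Adelic

/-- A system of eigenvalues `Φ : R → 𝔽` occurs in a space on which the elements of `R` act, if there
is an eigenform: some `f ≠ 0` with `f | T = Φ(T) f` for all `T ∈ R`. -/
def Occurs {R 𝔽 M : Type*} [Ring R] [Field 𝔽] [AddCommMonoid M] [Module 𝔽 M]
    (action : R → M →ₗ[𝔽] M) (Φ : R →+* 𝔽) : Prop :=
  ∃ f : M, f ≠ 0 ∧ ∀ T : R, action T f = Φ T • f

end AdelicHecke

end

open IsDedekindDomain NumberField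
open scoped nonZeroDivisors MatrixGroups

noncomputable section

namespace AdelicHecke

/-! ### Approximation in the adele ring -/

section Approximation

variable {R K : Type*} [CommRing R] [IsDedekindDomain R] [Field K] [Algebra R K]
  [IsFractionRing R K]

/-! Since determinants of `K` have trivial ideal class, `R(K, Δ)` is graded by the class group: its
part of degree `d` is supported on the `δ` with `(det δ) ∈ d`, and the part of degree one is `R(K,
Δ^{(1)})`. An element of degree `d` carries the component at `c` to the component at `d⁻¹ c`
(`adelicOperator_apply_eq_zero`). The theorem thus becomes a statement about a commutative graded
ring acting on a graded space, once the action is known to respect products.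

Products are respected for two reasons. Every coset of `K` is `K α_c g b⁻¹` with `g` rational, for
exactly one class `c`. Existence rests on strong approximation for `SL_n`
(`exists_eq_mul_diagonal_of_det_eq_one`) and the surjectivity of the determinant; uniqueness is read
off from the class of the determinant. Hence localizing a product gives the sum over `c` of the
composites through `Γ_c` (`localize_mul`). On cochains such a composite acts as the two operators in
succession only up to a coboundary, produced by a prism homotopy (`heckeCochain_compose`).

The algebra is as follows. Let `f` be homogeneous and an eigenvector of the degree-one part. If `Ψ`
vanishes in degree `d` but some `x` of that degree has `f | x ≠ 0`, replace `f` by `f | x`. This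
remains an eigenvector by commutativity, and the number of degrees acting nontrivially on it drops.
So eventually every degree where `Ψ` vanishes kills `f` (`exists_eigenvector_forall_apply_eq_zero`).
In each other degree choose `y` with `Ψ y ≠ 0` and put `u_d = (Ψ y)⁻¹ f | y`, which is independent
of `y`; in the killed degrees put `u_d = 0`. Homogeneous elements permute the `u_d` up to the scalar
`Ψ`, so `∑ u_d` is an eigenvector for all of `R(K, Δ)`. It is nonzero because the `u_d` lie in
different components and `u_1 = f`. -/

theorem setOf_valued_sub_lt_mem_nhds (v : HeightOneSpectrum R) (z : v.adicCompletion K)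
    {δ : WithZero (Multiplicative ℤ)} (hδ : δ ≠ 0) :
    {t : v.adicCompletion K | Valued.v (z - t) < δ} ∈ nhds z := by
  -- Basic neighbourhoods are indexed by values of the valuation, so `δ` is first realised as one.
  obtain ⟨c, rfl⟩ := v.valuedAdicCompletion_surjective K δ
  rw [Valued.mem_nhds]
  refine ⟨Units.mk0 (Valued.v.restrict c) ?_, fun t ht => ?_⟩
  · rw [Ne, Valuation.zero_iff]
    exact fun h => hδ (by rw [h, map_zero])
  · have h : Valued.v.restrict (t - z) < Valued.v.restrict c := ht
    rw [Valuation.restrict_lt_iff] at h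
    rw [Set.mem_ofPred_eq, Valuation.map_sub_swap]
    exact h

/-- `K` is dense in the completion. An approximation closer than `1` to an integral element is
itself integral at `v`, and can then be approximated from `R`; this is why `min δ 1` is used. -/
theorem exists_valued_sub_algebraMap_lt (v : HeightOneSpectrum R) (z : v.adicCompletion K)
    (hz : Valued.v z ≤ 1) {δ : WithZero (Multiplicative ℤ)} (hδ : δ ≠ 0) :
    ∃ y : R, Valued.v (z - ((algebraMap R K y : K) : v.adicCompletion K)) < δ := by
  have hd : min δ 1 ≠ 0 := by
    rcases min_choice δ 1 with h | h <;> rw [h]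
    exacts [hδ, one_ne_zero]
  obtain ⟨_, ⟨k, rfl⟩, hk'⟩ := (HeightOneSpectrum.denseRange_algebraMap K v).inter_nhds_nonempty
    (setOf_valued_sub_lt_mem_nhds v z hd)
  have hk : Valued.v (z - (k : v.adicCompletion K)) < min δ 1 := hk'
  have hk1 : v.valuation K k ≤ 1 := by
    rw [← HeightOneSpectrum.valuedAdicCompletion_eq_valuation']
    have h : (k : v.adicCompletion K) = z - (z - k) := by abel
    rw [h]
    exact Valuation.map_sub_le _ hz (hk.le.trans (min_le_right _ _))
  obtain ⟨y, hy⟩ := v.exists_valuation_sub_lt_of_integer hk1 (Units.mk0 δ hδ)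
  refine ⟨y, ?_⟩
  have h : z - ((algebraMap R K y : K) : v.adicCompletion K)
      = (z - k) - ((algebraMap R K y - k : K) : v.adicCompletion K) := by
    rw [sub_eq_add_neg (algebraMap R K y), HeightOneSpectrum.adicCompletion.coe_add]
    have h0 : ((-k : K) : v.adicCompletion K) = -(k : v.adicCompletion K) := by
      rw [eq_neg_iff_add_eq_zero, ← HeightOneSpectrum.adicCompletion.coe_add, neg_add_cancel,
        HeightOneSpectrum.adicCompletion.coe_zero]
    rw [h0]
    abel
  rw [h]
  refine Valuation.map_sub_lt _ (hk.trans_le (min_le_left _ _)) ?_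
  rw [HeightOneSpectrum.valuedAdicCompletion_eq_valuation']
  exact hy

/-- Chinese remainder theorem modulo powers `v ^ n v` so high that `exp (-n v) < δ v`. -/
theorem exists_forall_intValuation_sub_lt (s : Finset (HeightOneSpectrum R))
    (x : HeightOneSpectrum R → R) (δ : HeightOneSpectrum R → WithZero (Multiplicative ℤ))
    (hδ : ∀ v, δ v ≠ 0) : ∃ y : R, ∀ v ∈ s, v.intValuation (y - x v) < δ v := by
  choose n hn using fun v => WithZero.exists_exp_neg_natCast_lt (hδ v)
  obtain ⟨y, hy⟩ := IsDedekindDomain.exists_forall_sub_mem_ideal (s := s)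
    (fun v => v.asIdeal) n (fun v _ => v.prime) (fun v _ w _ h h' => h (HeightOneSpectrum.ext h'))
    (fun v => x v)
  exact ⟨y, fun v hv => lt_of_le_of_lt ((v.intValuation_le_pow_iff_mem _ _).2 (hy v hv)) (hn v)⟩

/-- A common denominator: an adele is integral at almost all places, and the product of local
denominators at the others serves everywhere. -/
theorem exists_ne_zero_forall_valued_mul_le_one (a : FiniteAdeleRing R K) :
    ∃ b : R, b ≠ 0 ∧
      ∀ v, Valued.v (a v * ((algebraMap R K b : K) : v.adicCompletion K)) ≤ 1 := by
  classical
  have hfin : {v : HeightOneSpectrum R | ¬ a v ∈ v.adicCompletionIntegers K}.Finite := a.2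
  choose b hb hab using fun v : HeightOneSpectrum R =>
    HeightOneSpectrum.adicCompletion.mul_nonZeroDivisor_mem_adicCompletionIntegers v (a v)
  have hint : ∀ (v : HeightOneSpectrum R) (r : R),
      Valued.v ((algebraMap R K r : K) : v.adicCompletion K) ≤ 1 := fun v r => by
    rw [HeightOneSpectrum.valuedAdicCompletion_eq_valuation']
    exact v.valuation_le_one r
  refine ⟨∏ v ∈ hfin.toFinset, b v,
    Finset.prod_ne_zero_iff.2 fun v _ => nonZeroDivisors.ne_zero (hb v), fun v => ?_⟩
  by_cases hv : a v ∈ v.adicCompletionIntegers K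
  · rw [map_mul]
    exact mul_le_one' hv (hint v _)
  · rw [← Finset.mul_prod_erase _ _ (hfin.mem_toFinset.2 hv), map_mul (algebraMap R K),
      HeightOneSpectrum.adicCompletion.coe_mul, ← mul_assoc, map_mul]
    exact mul_le_one' (hab v) (hint v _)

/-- Density of `K` in its finite adele ring. -/
theorem exists_forall_valued_sub_lt (a : FiniteAdeleRing R K) (s : Finset (HeightOneSpectrum R))
    (γ : HeightOneSpectrum R → WithZero (Multiplicative ℤ)) (hγ : ∀ v, γ v ≠ 0) :
    ∃ x : K, (∀ v ∈ s, Valued.v (a v - (x : v.adicCompletion K)) < γ v) ∧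
      ∀ v, Valued.v (a v - (x : v.adicCompletion K)) ≤ 1 := by
  classical
  obtain ⟨b, hb0, hb⟩ := exists_ne_zero_forall_valued_mul_le_one a
  have hbK : algebraMap R K b ≠ 0 := (map_ne_zero_iff _ (IsFractionRing.injective R K)).2 hb0
  have hvb : ∀ v : HeightOneSpectrum R, v.valuation K (algebraMap R K b) ≠ 0 := fun v =>
    (Valuation.ne_zero_iff _).2 hbK
  -- The element of `K` will be `z / b` with `z` close to `a b`; dividing by `b` costs the valuation
  -- of `b`, so it is included in the required precision.
  have hγ' : ∀ v, min (γ v) 1 * v.valuation K (algebraMap R K b) ≠ 0 := fun v => by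
    refine mul_ne_zero ?_ (hvb v)
    rcases min_choice (γ v) 1 with h | h <;> rw [h]
    exacts [hγ v, one_ne_zero]
  choose y hy using fun v => exists_valued_sub_algebraMap_lt v _ (hb v) (hγ' v)
  -- The primes dividing `b` join `s`. At all remaining primes `b` is a unit, so `a - z / b` is
  -- integral without any condition on `z`.
  have hfin : {v : HeightOneSpectrum R | v.asIdeal ∣ Ideal.span {b}}.Finite :=
    Ideal.finite_factors (by simpa using hb0)
  obtain ⟨z, hz⟩ := exists_forall_intValuation_sub_lt (s ∪ hfin.toFinset) y _ hγ'
  have hsub : ∀ (v : HeightOneSpectrum R) (p q : K), ((p - q : K) : v.adicCompletion K)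
      = (p : v.adicCompletion K) - (q : v.adicCompletion K) := fun v p q => by
    rw [eq_sub_iff_add_eq, ← HeightOneSpectrum.adicCompletion.coe_add, sub_add_cancel]
  have hmul : ∀ v : HeightOneSpectrum R,
      Valued.v (a v - ((algebraMap R K z / algebraMap R K b : K) : v.adicCompletion K))
        * v.valuation K (algebraMap R K b)
      = Valued.v (a v * ((algebraMap R K b : K) : v.adicCompletion K)
        - ((algebraMap R K z : K) : v.adicCompletion K)) := fun v => by
    rw [← HeightOneSpectrum.valuedAdicCompletion_eq_valuation', ← map_mul, sub_mul,
      ← HeightOneSpectrum.adicCompletion.coe_mul, div_mul_cancel₀ _ hbK]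
  have key : ∀ v ∈ s ∪ hfin.toFinset,
      Valued.v (a v - ((algebraMap R K z / algebraMap R K b : K) : v.adicCompletion K))
        < min (γ v) 1 := fun v hv => by
    have h1 : Valued.v (a v * ((algebraMap R K b : K) : v.adicCompletion K)
        - ((algebraMap R K z : K) : v.adicCompletion K))
        < min (γ v) 1 * v.valuation K (algebraMap R K b) := by
      have h2 : a v * ((algebraMap R K b : K) : v.adicCompletion K)
          - ((algebraMap R K z : K) : v.adicCompletion K)
          = (a v * ((algebraMap R K b : K) : v.adicCompletion K)
            - ((algebraMap R K (y v) : K) : v.adicCompletion K))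
            - ((algebraMap R K (z - y v) : K) : v.adicCompletion K) := by
        rw [map_sub, hsub]
        abel
      rw [h2]
      refine Valuation.map_sub_lt _ (hy v) ?_
      rw [HeightOneSpectrum.valuedAdicCompletion_eq_valuation',
        HeightOneSpectrum.valuation_of_algebraMap]
      exact hz v hv
    rw [← hmul] at h1
    exact lt_of_mul_lt_mul_right' h1
  refine ⟨algebraMap R K z / algebraMap R K b, fun v hv => ?_, fun v => ?_⟩
  · exact (key v (Finset.mem_union_left _ hv)).trans_le (min_le_left _ _)
  · by_cases hv : v.asIdeal ∣ Ideal.span {b}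
    · exact ((key v (Finset.mem_union_right _ (hfin.mem_toFinset.2 hv))).trans_le
        (min_le_right _ _)).le
    · have h1 : v.valuation K (algebraMap R K b) = 1 := by
        rw [HeightOneSpectrum.valuation_of_algebraMap]
        exact le_antisymm (v.intValuation_le_one b)
          (not_lt.1 fun h => hv ((v.intValuation_lt_one_iff_dvd b).1 h))
      have h2 := hmul v
      rw [h1, mul_one] at h2
      rw [h2]
      refine Valuation.map_sub_le _ (hb v) ?_
      rw [HeightOneSpectrum.valuedAdicCompletion_eq_valuation']
      exact v.valuation_le_one z

end Approximation

/-! ### Neighbourhoods of zero in the adeles and additive strong approximation. -/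

section Adeles

/-- Near zero the restricted product carries the product topology of the rings of integers, so a
neighbourhood restricts only finitely many coordinates beyond integrality. -/
theorem FiniteAdeleRing.exists_of_mem_nhds_zero {R K : Type*} [CommRing R] [IsDedekindDomain R]
    [Field K] [Algebra R K] [IsFractionRing R K] {N : Set (FiniteAdeleRing R K)}
    (hN : N ∈ nhds 0) : ∃ (s : Finset (HeightOneSpectrum R))
      (γ : HeightOneSpectrum R → WithZero (Multiplicative ℤ)), (∀ v, γ v ≠ 0) ∧
        ∀ a : FiniteAdeleRing R K, (∀ v, Valued.v (a v) ≤ 1) →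
          (∀ v ∈ s, Valued.v (a v) < γ v) → a ∈ N := by
  classical
  have hopen : ∀ v : HeightOneSpectrum R,
      IsOpen (v.adicCompletionIntegers K : Set (v.adicCompletion K)) :=
    fun v => Valued.isOpen_valuationSubring _
  have h := RestrictedProduct.nhds_zero_eq_map_structureMap
    (R := fun v : HeightOneSpectrum R => v.adicCompletion K)
    (B := fun v => v.adicCompletionIntegers K) hopen
  have hN' : N ∈ Filter.map (RestrictedProduct.structureMap
      (fun v : HeightOneSpectrum R => v.adicCompletion K)
      (fun v => (v.adicCompletionIntegers K : Set (v.adicCompletion K))) Filter.cofinite)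
      (nhds 0) := by
    rw [← h]
    exact hN
  have hN2 := Filter.mem_map.1 hN'
  rw [nhds_pi, Filter.mem_pi] at hN2
  obtain ⟨I, hI, t, ht, hIt⟩ := hN2
  have ht' : ∀ v, ∃ γ : WithZero (Multiplicative ℤ), γ ≠ 0 ∧
      ∀ x : v.adicCompletionIntegers K, Valued.v (x : v.adicCompletion K) < γ → x ∈ t v := by
    intro v
    obtain ⟨u, hu, hut⟩ := mem_nhds_subtype _ _ _ |>.1 (ht v)
    obtain ⟨γ, hγ⟩ := Valued.mem_nhds.1 hu
    refine ⟨MonoidWithZeroHom.ValueGroup₀.embedding γ.1, (map_ne_zero _).2 γ.ne_zero,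
      fun x hx => hut (hγ ?_)⟩
    rw [← Valuation.restrict_lt_iff_lt_embedding] at hx
    rw [Set.mem_ofPred_eq]
    simpa using hx
  choose γ hγ hγt using ht'
  refine ⟨hI.toFinset, γ, hγ, fun a ha has => ?_⟩
  let z : (v : HeightOneSpectrum R) → v.adicCompletionIntegers K := fun v => ⟨a v, ha v⟩
  have h1 : z ∈ I.pi t := fun v hv => hγt v (z v) (has v (hI.mem_toFinset.2 hv))
  have h2 := Set.mem_preimage.1 (hIt h1)
  exact h2

variable {F : Type*} [Field F] [NumberField F]

theorem AdeleRing.exists_of_mem_nhds_zero {N : Set (AdeleRing (𝓞 F) F)} (hN : N ∈ nhds 0) :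
    ∃ (s : Finset (HeightOneSpectrum (𝓞 F)))
      (γ : HeightOneSpectrum (𝓞 F) → WithZero (Multiplicative ℤ)), (∀ v, γ v ≠ 0) ∧
        ∀ a : AdeleRing (𝓞 F) F, a.1 = 0 → (∀ v, Valued.v (a.2 v) ≤ 1) →
          (∀ v ∈ s, Valued.v (a.2 v) < γ v) → a ∈ N := by
  have hc : Continuous (fun b : FiniteAdeleRing (𝓞 F) F => ((0, b) : AdeleRing (𝓞 F) F)) :=
    Continuous.prodMk continuous_const continuous_id
  obtain ⟨s, γ, hγ, h⟩ := FiniteAdeleRing.exists_of_mem_nhds_zero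
    (hc.continuousAt.preimage_mem_nhds (x := 0) hN)
  refine ⟨s, γ, hγ, fun a ha h1 h2 => ?_⟩
  have h3 := h a.2 h1 h2
  have h4 : a = (0, a.2) := Prod.ext ha rfl
  rw [h4]
  exact h3

/-- The completion is a copy of `ℝ` or `ℂ`. Connectedness is what makes the infinite places impose
no condition in additive approximation. -/
instance (v : InfinitePlace F) : PreconnectedSpace v.Completion := by
  rcases v.isReal_or_isComplex with hv | hv
  · exact (InfinitePlace.Completion.isometryEquivRealOfIsReal hv).symm.surjective.denseRange.preconnectedSpace
      (InfinitePlace.Completion.isometryEquivRealOfIsReal hv).symm.continuous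
  · exact (InfinitePlace.Completion.isometryEquivComplexOfIsComplex hv).symm.surjective.denseRange.preconnectedSpace
      (InfinitePlace.Completion.isometryEquivComplexOfIsComplex hv).symm.continuous

instance : PreconnectedSpace (InfiniteAdeleRing F) :=
  inferInstanceAs (PreconnectedSpace ((v : InfinitePlace F) → v.Completion))

/-- An open subgroup is also closed, so it meets the connected space of infinite adeles in
everything. -/
theorem AdeleRing.mem_of_isOpen_of_snd_eq_zero {U : AddSubgroup (AdeleRing (𝓞 F) F)}
    (hU : IsOpen (U : Set (AdeleRing (𝓞 F) F))) {a : AdeleRing (𝓞 F) F} (ha : a.2 = 0) :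
    a ∈ U := by
  have hcl := U.isClosed_of_isOpen hU
  have hc : Continuous (fun b : InfiniteAdeleRing F => ((b, 0) : AdeleRing (𝓞 F) F)) :=
    Continuous.prodMk continuous_id continuous_const
  have h := IsClopen.eq_univ ⟨hcl.preimage hc, hU.preimage hc⟩ ⟨0, U.zero_mem⟩
  have h1 := h.symm.subset (Set.mem_univ a.1)
  have h4 : a = (a.1, 0) := Prod.ext rfl ha
  rw [h4]
  exact h1

/-- Strong approximation for the additive group. -/
theorem AdeleRing.exists_sub_algebraMap_mem {U : AddSubgroup (AdeleRing (𝓞 F) F)}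
    (hU : IsOpen (U : Set (AdeleRing (𝓞 F) F))) (a : AdeleRing (𝓞 F) F) :
    ∃ x : F, a - algebraMap F _ x ∈ U := by
  obtain ⟨s, γ, hγ, h⟩ := AdeleRing.exists_of_mem_nhds_zero (hU.mem_nhds U.zero_mem)
  obtain ⟨x, hx, hx'⟩ := exists_forall_valued_sub_lt a.2 s γ hγ
  refine ⟨x, ?_⟩
  have h1 : a - algebraMap F _ x = (((a - algebraMap F _ x).1, 0) : AdeleRing (𝓞 F) F)
      + ((0, (a - algebraMap F _ x).2) : AdeleRing (𝓞 F) F) :=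
    Prod.ext (add_zero _).symm (zero_add _).symm
  rw [h1]
  exact U.add_mem (AdeleRing.mem_of_isOpen_of_snd_eq_zero hU rfl) (h _ rfl hx' hx)

end Adeles

/-! ### Strong approximation for `SL_n` -/

section Transvections

open Matrix

variable {ι : Type*} [Fintype ι] [DecidableEq ι]

/-- With `w(a) = e_{ij}(a) e_{ji}(-a⁻¹) e_{ij}(a)`, this is the classical identity `diag(a, a⁻¹) =
w(a) w(-1)`. -/
theorem diagonal_eq_prod_transvection {L : Type*} [Field L] {i j : ι} (hij : i ≠ j) {a : L}
    (ha : a ≠ 0) :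
    Matrix.diagonal (fun k => if k = i then a else if k = j then a⁻¹ else 1) =
      Matrix.transvection i j a * Matrix.transvection j i (-a⁻¹) * Matrix.transvection i j a *
      Matrix.transvection i j (-1) * Matrix.transvection j i 1 * Matrix.transvection i j (-1) := by
  simp only [Matrix.transvection, mul_add, add_mul, one_mul, mul_one, single_mul_single_same,
    single_mul_single_of_ne _ _ _ _ hij, single_mul_single_of_ne _ _ _ _ hij.symm,
    mul_inv_cancel₀ ha, inv_mul_cancel₀ ha, mul_neg, neg_mul, neg_neg, add_zero]
  ext k l
  simp only [Matrix.add_apply, diagonal_apply, single_apply, one_apply]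
  by_cases h1 : i = k
  · subst h1
    by_cases h3 : i = l
    · subst h3
      simp [hij.symm]
    · by_cases h4 : j = l
      · subst h4
        simp [hij, hij.symm]
      · simp [h3, h4, hij.symm]
  · by_cases h2 : j = k
    · subst h2
      by_cases h3 : i = l
      · subst h3
        simp [hij, hij.symm]
      · by_cases h4 : j = l
        · subst h4
          simp [hij, hij.symm]
        · simp [h3, h4, hij]
    · simp [h1, h2, Ne.symm h1, Ne.symm h2]

variable {R : Type*} [CommRing R]

/-- The elementary matrix `1 + b E_{ij}` as an element of `GL_n(R)`. -/
def elementary {i j : ι} (hij : i ≠ j) (b : R) : GL ι R where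
  val := Matrix.transvection i j b
  inv := Matrix.transvection i j (-b)
  val_inv := by
    rw [Matrix.transvection_mul_transvection_same i j hij, add_neg_cancel,
      Matrix.transvection_zero]
  inv_val := by
    rw [Matrix.transvection_mul_transvection_same i j hij, neg_add_cancel,
      Matrix.transvection_zero]

theorem elementary_add {i j : ι} (hij : i ≠ j) (b c : R) :
    elementary hij (b + c) = elementary hij b * elementary hij c :=
  Units.ext (Matrix.transvection_mul_transvection_same i j hij b c).symm

theorem elementary_zero {i j : ι} (hij : i ≠ j) : elementary hij (0 : R) = 1 :=
  Units.ext (Matrix.transvection_zero i j)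

theorem elementary_neg {i j : ι} (hij : i ≠ j) (b : R) :
    elementary hij (-b) = (elementary hij b)⁻¹ :=
  eq_inv_of_mul_eq_one_left (by rw [← elementary_add, neg_add_cancel, elementary_zero])

theorem map_elementary {R' : Type*} [CommRing R'] (f : R →+* R') {i j : ι} (hij : i ≠ j) (b : R) :
    Matrix.GeneralLinearGroup.map f (elementary hij b) = elementary hij (f b) := by
  ext k l
  simp [elementary, Matrix.transvection, Matrix.one_apply, Matrix.single_apply, apply_ite f]

theorem continuous_elementary [TopologicalSpace R] [IsTopologicalRing R] {i j : ι} (hij : i ≠ j) :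
    Continuous (elementary hij : R → GL ι R) := by
  have h : Continuous fun b : R => Matrix.transvection i j b :=
    continuous_matrix fun k l => by
      simp only [Matrix.transvection, Matrix.add_apply, Matrix.single_apply]
      split_ifs
      · exact continuous_const.add continuous_id
      · exact continuous_const
  exact Units.continuous_iff.2 ⟨h, h.comp continuous_neg⟩

variable (ι R) in
/-- The subgroup of `GL_n(R)` generated by the elementary matrices. -/
def elementarySubgroup : Subgroup (GL ι R) :=
  Subgroup.closure {g | ∃ (i j : ι) (hij : i ≠ j) (b : R), g = elementary hij b}

theorem elementary_mem {i j : ι} (hij : i ≠ j) (b : R) :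
    elementary hij b ∈ elementarySubgroup ι R :=
  Subgroup.subset_closure ⟨i, j, hij, b, rfl⟩

/-- For a field `L` that is a direct factor of `R`, the group `SL_n(L) ⊆ GL_n(R)` is contained in the
elementary subgroup. -/
theorem exists_elementarySubgroup_eq {L : Type*} [Field L] (e : L →ₙ+* R) (M : Matrix ι ι L)
    (hM : M.det = 1) : ∃ y ∈ elementarySubgroup ι R, (y : Matrix ι ι R) = 1 + (M - 1).map e := by
  -- The generation theorem for `SL_n` needs two distinct indices; for size at most one, determinant
  -- `1` already forces `M = 1`.
  rcases subsingleton_or_nontrivial ι with hι | hι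
  · have h : M = 1 := by
      ext i j
      rw [Subsingleton.elim j i]
      have := Matrix.det_eq_elem_of_subsingleton M i
      rw [← this, hM, Matrix.one_apply_eq]
    refine ⟨1, one_mem _, ?_⟩
    rw [h, sub_self]
    ext i j
    simp
  let P : Matrix ι ι L → Prop := fun M =>
    ∃ y ∈ elementarySubgroup ι R, (y : Matrix ι ι R) = 1 + (M - 1).map e
  have hmul : ∀ A B, P A → P B → P (A * B) := by
    rintro A B ⟨y, hy, h1⟩ ⟨z, hz, h2⟩
    refine ⟨y * z, mul_mem hy hz, ?_⟩
    -- As `e` need not preserve `1`, it is `M ↦ 1 + e(M - 1)` that is multiplicative, by this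
    -- identity.
    have h3 : A * B - 1 = (A - 1) + (B - 1) + (A - 1) * (B - 1) := by noncomm_ring
    rw [Units.val_mul, h1, h2, h3, Matrix.map_add _ (map_add e), Matrix.map_add _ (map_add e),
      Matrix.map_mul]
    noncomm_ring
  have ht : ∀ (i j : ι) (_ : i ≠ j) (c : L), P (Matrix.transvection i j c) := by
    intro i j hij c
    refine ⟨elementary hij (e c), elementary_mem hij _, ?_⟩
    ext k l
    simp [elementary, Matrix.transvection, Matrix.single_apply]
  -- `SL_n` of a field is generated by transvections and the matrices `diag(a, a⁻¹)`; the latter are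
  -- products of transvections by `diagonal_eq_prod_transvection`.
  exact SpecialLinearGroup.diagonal_transvection_induction' (fun g => P g.1) ⟨M, hM⟩
    (fun i j hij c hc => by
      rw [SpecialLinearGroup.diag2n_coe, diagonal_eq_prod_transvection hij hc]
      exact hmul _ _ (hmul _ _ (hmul _ _ (hmul _ _ (hmul _ _ (ht _ _ hij _) (ht _ _ hij.symm _))
        (ht _ _ hij _)) (ht _ _ hij _)) (ht _ _ hij.symm _)) (ht _ _ hij _))
    ht (fun A B => hmul A.1 B.1)

theorem det_eq_one_of_mem_elementarySubgroup {y : GL ι R} (hy : y ∈ elementarySubgroup ι R) :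
    Matrix.GeneralLinearGroup.det y = 1 := by
  have h : elementarySubgroup ι R ≤ (Matrix.GeneralLinearGroup.det (n := ι) (R := R)).ker := by
    refine (Subgroup.closure_le _).2 ?_
    rintro _ ⟨i, j, hij, b, rfl⟩
    exact Units.ext (Matrix.det_transvection_of_ne i j hij b)
  exact h hy

/-- A field which is a direct factor of `R` can be cleared by an elementary factor. -/
theorem exists_elementarySubgroup_map_eq_one {L : Type*} [Field L] (e : L →ₙ+* R) (π : R →+* L)
    (hπ : ∀ x, π (e x) = x) (y : GL ι R) (hy : Matrix.GeneralLinearGroup.det y = 1) :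
    ∃ p ∈ elementarySubgroup ι R, Matrix.GeneralLinearGroup.map π (y * p) = 1 ∧
      ∀ (L' : Type _) [CommRing L'] (σ : R →+* L'), (∀ x, σ (e x) = 0) →
        Matrix.GeneralLinearGroup.map σ p = 1 := by
  set g : GL ι L := (Matrix.GeneralLinearGroup.map π y)⁻¹ with hg
  have hdet : (g : Matrix ι ι L).det = 1 := by
    have h : Matrix.GeneralLinearGroup.det g = 1 := by
      rw [hg, map_inv, Matrix.GeneralLinearGroup.map_det, hy, map_one, inv_one]
    exact congrArg Units.val h
  obtain ⟨p, hp, h⟩ := exists_elementarySubgroup_eq e _ hdet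
  refine ⟨p, hp, ?_, fun L' _ σ hσ => ?_⟩
  · have h1 : Matrix.GeneralLinearGroup.map π p = g := by
      apply Units.ext
      change (p : Matrix ι ι R).map π = g
      rw [h]
      ext k l
      simp [hπ, Matrix.one_apply, apply_ite π]
    rw [map_mul, h1, hg, mul_inv_cancel]
  · apply Units.ext
    change (p : Matrix ι ι R).map σ = 1
    rw [h]
    ext k l
    simp [hσ, Matrix.one_apply, apply_ite σ]

end Transvections

/-! ### From approximation of elementary matrices to the decomposition of `GL_n(𝔸)`. -/

section StrongApproximation

variable (F : Type*) [Field F] [NumberField F]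

/-- The projection of the adele ring to the completion at a finite place. -/
def finiteProj (v : HeightOneSpectrum (𝓞 F)) : AdeleRing (𝓞 F) F →+* v.adicCompletion F where
  toFun a := a.2 v
  map_one' := rfl
  map_mul' _ _ := rfl
  map_zero' := rfl
  map_add' _ _ := rfl

/-- The projection of the adele ring to the completion at an infinite place. -/
def infiniteProj (v : InfinitePlace F) : AdeleRing (𝓞 F) F →+* v.Completion where
  toFun a := a.1 v
  map_one' := rfl
  map_mul' _ _ := rfl
  map_zero' := rfl
  map_add' _ _ := rfl

open Classical in
/-- The inclusion of the completion at an infinite place as a direct factor of the adele ring. -/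
def infiniteSingle (v : InfinitePlace F) : v.Completion →ₙ+* AdeleRing (𝓞 F) F where
  toFun x := ((Pi.single v x : (w : InfinitePlace F) → w.Completion), 0)
  map_mul' x y := Prod.ext (Pi.single_mul v x y) (mul_zero _).symm
  map_zero' := Prod.ext (Pi.single_zero v) rfl
  map_add' x y := Prod.ext (Pi.single_add v x y) (add_zero _).symm

open Classical in
/-- The inclusion of the completion at a finite place as a direct factor of the adele ring. -/
def finiteSingle (v : HeightOneSpectrum (𝓞 F)) :
    v.adicCompletion F →ₙ+* AdeleRing (𝓞 F) F where
  toFun x := (0, ⟨Pi.single v x, by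
    refine Set.Finite.subset (Set.finite_singleton v) fun w hw => ?_
    by_contra h
    refine hw ?_
    change Pi.single v x w ∈ w.adicCompletionIntegers F
    rw [Pi.single_eq_of_ne h]
    exact zero_mem _⟩)
  map_mul' x y := Prod.ext (mul_zero _).symm (Subtype.ext (Pi.single_mul v x y))
  map_zero' := Prod.ext rfl (Subtype.ext (Pi.single_zero v))
  map_add' x y := Prod.ext (add_zero _).symm (Subtype.ext (Pi.single_add v x y))

variable {F} {n : ℕ}

/-- The places are cleared one at a time: the factor clearing `v` is trivial at every other place,
so earlier corrections survive and finite components are untouched. -/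
theorem exists_elementarySubgroup_forall_infiniteProj
    (y : GL (Fin n) (AdeleRing (𝓞 F) F)) (hy : Matrix.GeneralLinearGroup.det y = 1)
    (s : Finset (InfinitePlace F)) :
    ∃ p ∈ elementarySubgroup (Fin n) (AdeleRing (𝓞 F) F),
      (∀ v ∈ s, Matrix.GeneralLinearGroup.map (infiniteProj F v) (y * p) = 1) ∧
      ∀ v, Matrix.GeneralLinearGroup.map (finiteProj F v) p = 1 := by
  classical
  induction s using Finset.induction_on with
  | empty =>
    exact ⟨1, one_mem _, fun v hv => absurd hv (Finset.notMem_empty v), fun v => map_one _⟩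
  | insert v s hv ih =>
    obtain ⟨p, hp, h, h'⟩ := ih
    obtain ⟨q, hq, h1, h2⟩ := exists_elementarySubgroup_map_eq_one (infiniteSingle F v)
      (infiniteProj F v) (fun x => Pi.single_eq_same v x) (y * p)
      (by rw [map_mul, hy, det_eq_one_of_mem_elementarySubgroup hp, one_mul])
    refine ⟨p * q, mul_mem hp hq, fun w hw => ?_, fun w => by
      rw [map_mul, h' w, h2 _ (finiteProj F w) (fun x => rfl), one_mul]⟩
    rw [← mul_assoc]
    rcases Finset.mem_insert.1 hw with rfl | hw
    · exact h1
    · have hwv : w ≠ v := fun h => hv (h ▸ hw)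
      rw [map_mul, h w hw, h2 _ (infiniteProj F w) (fun x => Pi.single_eq_of_ne hwv x), one_mul]

-- Once the infinite places are cleared, the places of `s` are treated in turn. Components of `y`
-- outside `s` stay unchanged, which preserves integrality there.
open Classical in
theorem exists_elementarySubgroup_forall_proj
    (y : GL (Fin n) (AdeleRing (𝓞 F) F)) (hy : Matrix.GeneralLinearGroup.det y = 1)
    (s : Finset (HeightOneSpectrum (𝓞 F))) :
    ∃ p ∈ elementarySubgroup (Fin n) (AdeleRing (𝓞 F) F),
      (∀ v, Matrix.GeneralLinearGroup.map (infiniteProj F v) (y * p) = 1) ∧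
      ∀ v, Matrix.GeneralLinearGroup.map (finiteProj F v) (y * p) =
        if v ∈ s then 1 else Matrix.GeneralLinearGroup.map (finiteProj F v) y := by
  induction s using Finset.induction_on with
  | empty =>
    obtain ⟨p, hp, h, h'⟩ := exists_elementarySubgroup_forall_infiniteProj y hy Finset.univ
    exact ⟨p, hp, fun v => h v (Finset.mem_univ v), fun v => by
      rw [map_mul, h' v, mul_one, if_neg (Finset.notMem_empty v)]⟩
  | insert v s hv ih =>
    obtain ⟨p, hp, h, h'⟩ := ih
    obtain ⟨q, hq, h1, h2⟩ := exists_elementarySubgroup_map_eq_one (finiteSingle F v)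
      (finiteProj F v) (fun x => Pi.single_eq_same v x) (y * p)
      (by rw [map_mul, hy, det_eq_one_of_mem_elementarySubgroup hp, one_mul])
    refine ⟨p * q, mul_mem hp hq, fun w => ?_, fun w => ?_⟩
    · rw [← mul_assoc, map_mul, h w, h2 _ (infiniteProj F w) (fun x => rfl), one_mul]
    · rw [← mul_assoc]
      by_cases hwv : w = v
      · rw [hwv, if_pos (Finset.mem_insert_self v s)]
        exact h1
      · rw [map_mul, h' w, h2 _ (finiteProj F w) (fun x => Pi.single_eq_of_ne hwv x), mul_one]
        simp [hwv]

/-- The topology on units is induced by `y ↦ (y, y⁻¹)`, so both matrices must be controlled; having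
finitely many entries allows one common `W`. -/
theorem exists_nhds_zero_of_mem_nhds_one {R : Type*} [CommRing R] [TopologicalSpace R]
    [IsTopologicalRing R] {N : Set (GL (Fin n) R)} (hN : N ∈ nhds 1) :
    ∃ W ∈ nhds (0 : R), ∀ y : GL (Fin n) R,
      (∀ i j, (y : Matrix (Fin n) (Fin n) R) i j - (1 : Matrix (Fin n) (Fin n) R) i j ∈ W) →
      (∀ i j, ((y⁻¹ : GL (Fin n) R) : Matrix (Fin n) (Fin n) R) i j
        - (1 : Matrix (Fin n) (Fin n) R) i j ∈ W) → y ∈ N := by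
  rw [Units.isInducing_embedProduct.nhds_eq_comap, Filter.mem_comap] at hN
  obtain ⟨t, ht, htN⟩ := hN
  rw [map_one, Prod.one_eq_mk, mem_nhds_prod_iff] at ht
  obtain ⟨u, hu, u', hu', huu⟩ := ht
  have hu2 : MulOpposite.op ⁻¹' u' ∈ nhds (1 : Matrix (Fin n) (Fin n) R) :=
    MulOpposite.continuous_op.continuousAt.preimage_mem_nhds hu'
  let e : Fin n → Fin n → R := fun i j => (1 : Matrix (Fin n) (Fin n) R) i j
  have key : ∀ u : Set (Fin n → Fin n → R), u ∈ nhds e → ∃ W ∈ nhds (0 : R),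
      ∀ M : Matrix (Fin n) (Fin n) R,
        (∀ i j, M i j - (1 : Matrix (Fin n) (Fin n) R) i j ∈ W) → M ∈ u := by
    intro u hu
    rw [nhds_pi, Filter.mem_pi'] at hu
    obtain ⟨I, t, ht, htu⟩ := hu
    have ht' : ∀ i, ∃ W ∈ nhds (0 : R), ∀ r : Fin n → R,
        (∀ j, r j - (1 : Matrix (Fin n) (Fin n) R) i j ∈ W) → r ∈ t i := by
      intro i
      have h := ht i
      rw [nhds_pi, Filter.mem_pi'] at h
      obtain ⟨J, s, hs, hst⟩ := h
      refine ⟨⋂ j, (fun w => w + (1 : Matrix (Fin n) (Fin n) R) i j) ⁻¹' s j,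
        Filter.iInter_mem.2 fun j => ?_, fun r hr => hst fun j _ => ?_⟩
      · refine (continuous_id.add continuous_const).continuousAt.preimage_mem_nhds ?_
        simpa [e] using hs j
      · simpa using Set.mem_iInter.1 (hr j) j
    choose W hW hWt using ht'
    exact ⟨⋂ i, W i, Filter.iInter_mem.2 hW, fun M hM => htu fun i _ =>
      hWt i _ fun j => Set.mem_iInter.1 (hM i j) i⟩
  obtain ⟨W, hW, h⟩ := key u hu
  obtain ⟨W', hW', h'⟩ := key _ hu2
  exact ⟨W ∩ W', Filter.inter_mem hW hW', fun y hy hy' => htN (huu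
    ⟨h _ fun i j => (hy i j).1, h' _ fun i j => (hy' i j).2⟩)⟩

theorem finiteProj_entry_eq_one {v : HeightOneSpectrum (𝓞 F)} {y : GL (Fin n) (AdeleRing (𝓞 F) F)}
    (hy : Matrix.GeneralLinearGroup.map (finiteProj F v) y = 1) (i j : Fin n) :
    finiteProj F v ((y : Matrix (Fin n) (Fin n) (AdeleRing (𝓞 F) F)) i j
      - (1 : Matrix (Fin n) (Fin n) (AdeleRing (𝓞 F) F)) i j) = 0 := by
  have h := congrArg (fun g : GL (Fin n) (v.adicCompletion F) =>
    (g : Matrix (Fin n) (Fin n) (v.adicCompletion F)) i j) hy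
  simp only [Matrix.GeneralLinearGroup.map_apply, Units.val_one] at h
  rw [map_sub, h, Matrix.one_apply, Matrix.one_apply, apply_ite (finiteProj F v), map_one, map_zero,
    sub_self]

theorem infiniteProj_entry_eq_one {v : InfinitePlace F} {y : GL (Fin n) (AdeleRing (𝓞 F) F)}
    (hy : Matrix.GeneralLinearGroup.map (infiniteProj F v) y = 1) (i j : Fin n) :
    infiniteProj F v ((y : Matrix (Fin n) (Fin n) (AdeleRing (𝓞 F) F)) i j
      - (1 : Matrix (Fin n) (Fin n) (AdeleRing (𝓞 F) F)) i j) = 0 := by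
  have h := congrArg (fun g : GL (Fin n) v.Completion =>
    (g : Matrix (Fin n) (Fin n) v.Completion) i j) hy
  simp only [Matrix.GeneralLinearGroup.map_apply, Units.val_one] at h
  rw [map_sub, h, Matrix.one_apply, Matrix.one_apply, apply_ite (infiniteProj F v), map_one,
    map_zero, sub_self]

/-- An open neighbourhood of `1` in `GL_n(𝔸)` contains every element which is trivial at the
infinite places and at finitely many finite places, and integral at the remaining places. -/
theorem exists_finset_forall_mem {N : Set (GL (Fin n) (AdeleRing (𝓞 F) F))} (hN : N ∈ nhds 1) :
    ∃ s : Finset (HeightOneSpectrum (𝓞 F)), ∀ y : GL (Fin n) (AdeleRing (𝓞 F) F),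
      (∀ v, Matrix.GeneralLinearGroup.map (infiniteProj F v) y = 1) →
      (∀ v, Matrix.GeneralLinearGroup.map (finiteProj F v) y = 1 ∨ (v ∉ s ∧
        ∀ i j,
          Valued.v (finiteProj F v ((y : Matrix (Fin n) (Fin n) (AdeleRing (𝓞 F) F)) i j)) ≤ 1 ∧
          Valued.v (finiteProj F v (((y⁻¹ : GL (Fin n) (AdeleRing (𝓞 F) F)) :
            Matrix (Fin n) (Fin n) (AdeleRing (𝓞 F) F)) i j)) ≤ 1)) →
      y ∈ N := by
  obtain ⟨W, hW, h⟩ := exists_nhds_zero_of_mem_nhds_one hN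
  obtain ⟨s, γ, hγ, hs⟩ := AdeleRing.exists_of_mem_nhds_zero hW
  have hs' : ∀ a : AdeleRing (𝓞 F) F, (∀ v, infiniteProj F v a = 0) →
      (∀ v, Valued.v (finiteProj F v a) ≤ 1) → (∀ v ∈ s, Valued.v (finiteProj F v a) < γ v) →
      a ∈ W := fun a h1 => hs a (funext h1)
  have key : ∀ y : GL (Fin n) (AdeleRing (𝓞 F) F),
      (∀ v, Matrix.GeneralLinearGroup.map (infiniteProj F v) y = 1) →
      (∀ v, Matrix.GeneralLinearGroup.map (finiteProj F v) y = 1 ∨ (v ∉ s ∧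
        ∀ i j,
          Valued.v (finiteProj F v ((y : Matrix (Fin n) (Fin n) (AdeleRing (𝓞 F) F)) i j)) ≤ 1)) →
      ∀ i j, (y : Matrix (Fin n) (Fin n) (AdeleRing (𝓞 F) F)) i j
        - (1 : Matrix (Fin n) (Fin n) (AdeleRing (𝓞 F) F)) i j ∈ W := by
    intro y h1 h2 i j
    refine hs' _ (fun v => infiniteProj_entry_eq_one (h1 v) i j) (fun v => ?_)
      fun v hv => ?_
    · rcases h2 v with h3 | ⟨_, h3⟩
      · rw [finiteProj_entry_eq_one h3 i j, map_zero]
        exact zero_le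
      · rw [map_sub]
        refine Valuation.map_sub_le _ (h3 i j) ?_
        rw [Matrix.one_apply, apply_ite (finiteProj F v), map_one, map_zero]
        split_ifs
        · rw [map_one]
        · rw [map_zero]
          exact zero_le
    · rcases h2 v with h3 | ⟨h3, _⟩
      · rw [finiteProj_entry_eq_one h3 i j, map_zero]
        exact zero_lt_iff.2 (hγ v)
      · exact absurd hv h3
  refine ⟨s, fun y h1 h2 => h y (key y h1 fun v => ?_) (key y⁻¹ (fun v => ?_) fun v => ?_)⟩
  · exact (h2 v).imp id fun h3 => ⟨h3.1, fun i j => (h3.2 i j).1⟩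
  · rw [map_inv, h1 v, inv_one]
  · exact (h2 v).imp (fun h3 => by rw [map_inv, h3, inv_one]) fun h3 =>
      ⟨h3.1, fun i j => (h3.2 i j).2⟩

/-- Approximation of products of elementary matrices. -/
theorem exists_eq_mul_diagonal_of_mem_elementarySubgroup {y : GL (Fin n) (AdeleRing (𝓞 F) F)}
    (hy : y ∈ elementarySubgroup (Fin n) (AdeleRing (𝓞 F) F)) :
    ∀ K : Subgroup (GL (Fin n) (AdeleRing (𝓞 F) F)),
      IsOpen (K : Set (GL (Fin n) (AdeleRing (𝓞 F) F))) →
      ∃ k ∈ K, ∃ g : GL (Fin n) F, y = k * diagonal F n g := by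
  have hel : ∀ (i j : Fin n) (hij : i ≠ j) (b : AdeleRing (𝓞 F) F)
      (K : Subgroup (GL (Fin n) (AdeleRing (𝓞 F) F))),
      IsOpen (K : Set (GL (Fin n) (AdeleRing (𝓞 F) F))) →
      ∃ k ∈ K, ∃ g : GL (Fin n) F, elementary hij b = k * diagonal F n g := by
    intro i j hij b K hK
    -- The `b` whose elementary matrix lies in `K` form an open additive subgroup, to which additive
    -- strong approximation applies.
    let U : AddSubgroup (AdeleRing (𝓞 F) F) :=
      { carrier := {a | elementary hij a ∈ K}
        zero_mem' := by
          rw [Set.mem_ofPred_eq, elementary_zero]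
          exact K.one_mem
        add_mem' := fun {a c} ha hc => by
          rw [Set.mem_ofPred_eq, elementary_add]
          exact K.mul_mem ha hc
        neg_mem' := fun {a} ha => by
          rw [Set.mem_ofPred_eq, elementary_neg]
          exact K.inv_mem ha }
    have hU : IsOpen (U : Set (AdeleRing (𝓞 F) F)) := hK.preimage (continuous_elementary hij)
    obtain ⟨x, hx⟩ := AdeleRing.exists_sub_algebraMap_mem hU b
    refine ⟨_, hx, elementary hij x, ?_⟩
    rw [diagonal, map_elementary, ← elementary_add, sub_add_cancel]
  have hmul : ∀ y z : GL (Fin n) (AdeleRing (𝓞 F) F),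
      (∀ K : Subgroup (GL (Fin n) (AdeleRing (𝓞 F) F)),
        IsOpen (K : Set (GL (Fin n) (AdeleRing (𝓞 F) F))) →
        ∃ k ∈ K, ∃ g : GL (Fin n) F, y = k * diagonal F n g) →
      (∀ K : Subgroup (GL (Fin n) (AdeleRing (𝓞 F) F)),
        IsOpen (K : Set (GL (Fin n) (AdeleRing (𝓞 F) F))) →
        ∃ k ∈ K, ∃ g : GL (Fin n) F, z = k * diagonal F n g) →
      ∀ K : Subgroup (GL (Fin n) (AdeleRing (𝓞 F) F)),
        IsOpen (K : Set (GL (Fin n) (AdeleRing (𝓞 F) F))) →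
        ∃ k ∈ K, ∃ g : GL (Fin n) F, y * z = k * diagonal F n g := by
    intro y z hy hz K hK
    obtain ⟨k, hk, g, rfl⟩ := hy K hK
    have hc : Continuous (MulAut.conj (diagonal F n g)) := by
      have : Continuous fun x => diagonal F n g * x * (diagonal F n g)⁻¹ := by fun_prop
      exact this
    -- With `y = k g`, moving `g` past the factor `l` of `z` conjugates it, so `z` is approximated
    -- with respect to `g⁻¹ K g`. This is why the claim is quantified over all open `K`.
    obtain ⟨l, hl, h, rfl⟩ := hz (K.comap (MulAut.conj (diagonal F n g)).toMonoidHom)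
      (hK.preimage hc)
    refine ⟨k * (diagonal F n g * l * (diagonal F n g)⁻¹), K.mul_mem hk hl, g * h, ?_⟩
    rw [map_mul]
    group
  induction hy using Subgroup.closure_induction_left with
  | one => exact fun K _ => ⟨1, K.one_mem, 1, by rw [map_one, mul_one]⟩
  | mul_left x hx y _ ih =>
    obtain ⟨i, j, hij, b, rfl⟩ := hx
    exact hmul _ _ (hel i j hij b) ih
  | inv_mul_cancel x hx y _ ih =>
    obtain ⟨i, j, hij, b, rfl⟩ := hx
    rw [← elementary_neg]
    exact hmul _ _ (hel i j hij (-b)) ih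

/-- Strong approximation for `SL_n`. -/
theorem exists_eq_mul_diagonal_of_det_eq_one {y : GL (Fin n) (AdeleRing (𝓞 F) F)}
    (hy : Matrix.GeneralLinearGroup.det y = 1) (K : Subgroup (GL (Fin n) (AdeleRing (𝓞 F) F)))
    (hK : IsOpen (K : Set (GL (Fin n) (AdeleRing (𝓞 F) F)))) :
    ∃ k ∈ K, ∃ g : GL (Fin n) F, y = k * diagonal F n g := by
  classical
  obtain ⟨s, hs⟩ := exists_finset_forall_mem (hK.mem_nhds K.one_mem)
  have hfin : ∀ a : AdeleRing (𝓞 F) F,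
      {v : HeightOneSpectrum (𝓞 F) | ¬ Valued.v (finiteProj F v a) ≤ 1}.Finite := fun a => a.2.2
  -- Outside `t` both `y` and `y⁻¹` are integral; inside `t` the component is made trivial. Then `y
  -- * p` lies in `K`, and only `p⁻¹`, a product of elementary matrices, is left to approximate.
  let t : Finset (HeightOneSpectrum (𝓞 F)) := s ∪ Finset.univ.biUnion fun ij : Fin n × Fin n =>
    (hfin ((y : Matrix (Fin n) (Fin n) (AdeleRing (𝓞 F) F)) ij.1 ij.2)).toFinset ∪
    (hfin (((y⁻¹ : GL (Fin n) (AdeleRing (𝓞 F) F)) : Matrix (Fin n) (Fin n) (AdeleRing (𝓞 F) F))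
      ij.1 ij.2)).toFinset
  obtain ⟨p, hp, h1, h2⟩ := exists_elementarySubgroup_forall_proj y hy t
  have hyp : y * p ∈ K := by
    refine hs _ h1 fun v => ?_
    by_cases hv : v ∈ t
    · left
      rw [h2 v, if_pos hv]
    · right
      have h3 : Matrix.GeneralLinearGroup.map (finiteProj F v) (y * p)
          = Matrix.GeneralLinearGroup.map (finiteProj F v) y := by rw [h2 v, if_neg hv]
      have h4 := congrArg (·⁻¹) h3
      simp only [← map_inv] at h4
      refine ⟨fun h => hv (Finset.mem_union_left _ h), fun i j => ⟨?_, ?_⟩⟩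
      · rw [← Matrix.GeneralLinearGroup.map_apply, h3, Matrix.GeneralLinearGroup.map_apply]
        by_contra h
        exact hv (Finset.mem_union_right _ (Finset.mem_biUnion.2 ⟨(i, j), Finset.mem_univ _,
          Finset.mem_union_left _ ((hfin _).mem_toFinset.2 h)⟩))
      · rw [← Matrix.GeneralLinearGroup.map_apply, h4, Matrix.GeneralLinearGroup.map_apply]
        by_contra h
        exact hv (Finset.mem_union_right _ (Finset.mem_biUnion.2 ⟨(i, j), Finset.mem_univ _,
          Finset.mem_union_right _ ((hfin _).mem_toFinset.2 h)⟩))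
  obtain ⟨k, hk, g, h⟩ := exists_eq_mul_diagonal_of_mem_elementarySubgroup
    (inv_mem hp) K hK
  refine ⟨y * p * k, K.mul_mem hyp hk, g, ?_⟩
  rw [mul_assoc, ← h, mul_inv_cancel_right]

/-- The decomposition `GL_n(𝔸) = ⋃_c K α_c GL_n(F)`. -/
theorem exists_eq_mul_mul_diagonal {K : Subgroup (GL (Fin n) (AdeleRing (𝓞 F) F))}
    (hK : IsOpen (K : Set (GL (Fin n) (AdeleRing (𝓞 F) F))))
    {α : ClassGroup (𝓞 F) → GL (Fin n) (AdeleRing (𝓞 F) F)}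
    (hdet : ∀ a : (AdeleRing (𝓞 F) F)ˣ, ∃ c, ∃ g : GL (Fin n) F, ∃ κ ∈ K,
      Matrix.GeneralLinearGroup.det (α c * diagonal F n g * κ) = a)
    (x : GL (Fin n) (AdeleRing (𝓞 F) F)) :
    ∃ c, ∃ κ ∈ K, ∃ g : GL (Fin n) F, x = κ * α c * diagonal F n g := by
  obtain ⟨c, g, κ, hκ, h⟩ := hdet (Matrix.GeneralLinearGroup.det x)
  have hc : Continuous (MulAut.conj (α c)) := by
    have : Continuous fun x => α c * x * (α c)⁻¹ := by fun_prop
    exact this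
  -- Because `det x = det (α_c g κ)`, this element has determinant `1`. The open subgroup is `α_c⁻¹
  -- K α_c`, so that its elements pass into `K` to the left of `α_c`.
  obtain ⟨k, hk, e, he⟩ := exists_eq_mul_diagonal_of_det_eq_one
    (y := (α c)⁻¹ * κ⁻¹ * x * (diagonal F n g)⁻¹)
    (by
      simp only [map_mul, map_inv] at h ⊢
      rw [← h, mul_comm (_ * _) (Matrix.GeneralLinearGroup.det κ)]
      group)
    (K.comap (MulAut.conj (α c)).toMonoidHom) (hK.preimage hc)
  refine ⟨c, κ * (α c * k * (α c)⁻¹), K.mul_mem hκ hk, e * g, ?_⟩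
  have h1 : x = κ * α c * ((α c)⁻¹ * κ⁻¹ * x * (diagonal F n g)⁻¹) * diagonal F n g := by group
  rw [h1, he, map_mul]
  group

end StrongApproximation

/-! ### Principal ideles -/

section PrincipalIdeles

variable {F : Type*} [Field F] [NumberField F]

theorem ideleOrd_algebraMap (v : HeightOneSpectrum (𝓞 F)) {p q : 𝓞 F} (hp : p ≠ 0) (hq : q ≠ 0)
    (x : Fˣ) (hx : (x : F) = algebraMap (𝓞 F) F p / algebraMap (𝓞 F) F q) :
    ideleOrd F v (Units.map (algebraMap F (AdeleRing (𝓞 F) F)).toMonoidHom x)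
      = (Associates.mk v.asIdeal).count (Associates.mk (Ideal.span {p})).factors
        - (Associates.mk v.asIdeal).count (Associates.mk (Ideal.span {q})).factors := by
  have h : Valued.v ((Units.map (algebraMap F (AdeleRing (𝓞 F) F)).toMonoidHom x :
      AdeleRing (𝓞 F) F).2 v) = v.valuation F (x : F) :=
    HeightOneSpectrum.valuedAdicCompletion_eq_valuation' v (x : F)
  rw [ideleOrd, h, hx, map_div₀, HeightOneSpectrum.valuation_of_algebraMap,
    HeightOneSpectrum.valuation_of_algebraMap, v.intValuation_if_neg hp, v.intValuation_if_neg hq,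
    ← WithZero.exp_sub, WithZero.log_exp]
  ring

/-- Writing `x = p / q`, the orders of the idele are the exponents in the prime factorization of the
fractional ideal of `x`, which is principal. -/
theorem ideleClass_algebraMap (x : Fˣ) :
    ideleClass F (Units.map (algebraMap F (AdeleRing (𝓞 F) F)).toMonoidHom x) = 1 := by
  obtain ⟨p, q, hq, hx⟩ := IsFractionRing.div_surjective (A := 𝓞 F) (x : F)
  have hq0 : q ≠ 0 := nonZeroDivisors.ne_zero hq
  have hp0 : p ≠ 0 := by
    rintro rfl
    exact x.ne_zero (by rw [← hx, map_zero, zero_div])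
  rw [ideleClass, MonoidHom.comp_apply, ClassGroup.mk_eq_one_iff]
  have h : ((ideleIdeal F (Units.map (algebraMap F (AdeleRing (𝓞 F) F)).toMonoidHom x) :
      (FractionalIdeal (𝓞 F)⁰ F)ˣ) : FractionalIdeal (𝓞 F)⁰ F)
      = FractionalIdeal.spanSingleton (𝓞 F)⁰ (x : F) := by
    have h1 := FractionalIdeal.finprod_heightOneSpectrum_factorization_principal_fraction
      (K := F) hp0 ⟨q, hq⟩
    rw [IsFractionRing.mk'_eq_div] at h1
    rw [← hx, ← h1]
    change Units.coeHom _ (∏ᶠ v, _) = _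
    rw [MonoidHom.map_finprod _ (finite_ideleOrd F _)]
    refine finprod_congr fun v => ?_
    rw [ideleOrd_algebraMap v hp0 hq0 x hx.symm]
    rw [Units.coeHom_apply, Units.val_zpow_eq_zpow_val]
    rfl
  rw [h]
  exact ⟨⟨(x : F), by rw [FractionalIdeal.coe_spanSingleton]⟩⟩

theorem detClass_diagonal {n : ℕ} (g : GL (Fin n) F) : detClass F n (diagonal F n g) = 1 := by
  have h : Matrix.GeneralLinearGroup.det (diagonal F n g)
      = Units.map (algebraMap F (AdeleRing (𝓞 F) F)).toMonoidHom
          (Matrix.GeneralLinearGroup.det g) := Matrix.GeneralLinearGroup.map_det _ _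
  rw [detClass, MonoidHom.comp_apply, h, ideleClass_algebraMap]

end PrincipalIdeles

/-! ### Functoriality of Hecke operators on cohomology -/

section Prism

variable {A B V : Type*} [AddCommGroup V]

/-- The homogeneous coboundary, on functions of any number of variables. -/
def alternatingSum (m : ℕ) (f : (Fin m → B) → V) (x : Fin (m + 1) → B) : V :=
  ∑ j : Fin (m + 1), (-1 : ℤ) ^ (j : ℕ) • f (fun k => x (j.succAbove k))

theorem alternatingSum_sub (m : ℕ) (f g : (Fin m → B) → V) (x : Fin (m + 1) → B) :
    alternatingSum m (fun z => f z - g z) x = alternatingSum m f x - alternatingSum m g x := by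
  simp only [alternatingSum, smul_sub, Finset.sum_sub_distrib]

theorem alternatingSum_comp (m : ℕ) (f : (Fin m → B) → V) (t : A → B) (x : Fin (m + 1) → A) :
    alternatingSum m (fun z => f (t ∘ z)) x = alternatingSum m f (t ∘ x) := rfl

/-- Freezing the first variable; this recursion drives the induction for the prism operator. -/
theorem alternatingSum_cons (m : ℕ) (f : (Fin (m + 1) → B) → V) (a : B) (x : Fin (m + 1) → B) :
    alternatingSum (m + 1) f (Fin.cons a x : Fin (m + 2) → B)
      = f x - alternatingSum m (fun z => f (Fin.cons a z : Fin (m + 1) → B)) x := by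
  rw [alternatingSum, Fin.sum_univ_succ, sub_eq_add_neg, alternatingSum, ← Finset.sum_neg_distrib]
  congr 1
  · simp
  · refine Finset.sum_congr rfl fun j _ => ?_
    have h : (fun k => (Fin.cons a x : Fin (m + 2) → B) (j.succ.succAbove k))
        = (Fin.cons a (fun k => x (j.succAbove k)) : Fin (m + 1) → B) := by
      funext k
      refine Fin.cases ?_ (fun k => ?_) k
      · simp
      · simp
    rw [h, Fin.val_succ, pow_succ]
    simp

/-- The prism operator: the homotopy between the pullbacks along two maps `s` and `t`. -/
def prism (s t : A → B) : (m : ℕ) → ((Fin (m + 1) → B) → V) → (Fin m → A) → V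
  | 0, _, _ => 0
  | m + 1, f, x =>
    f (Fin.cons (s (x 0)) (Fin.cons (t (x 0)) (t ∘ Fin.tail x) : Fin (m + 1) → B))
      - prism s t m (fun z => f (Fin.cons (s (x 0)) z : Fin (m + 2) → B)) (Fin.tail x)

theorem prism_cons (s t : A → B) (m : ℕ) (f : (Fin (m + 2) → B) → V) (a : A) (x : Fin m → A) :
    prism s t (m + 1) f (Fin.cons a x : Fin (m + 1) → A)
      = f (Fin.cons (s a) (Fin.cons (t a) (t ∘ x) : Fin (m + 1) → B))
        - prism s t m (fun z => f (Fin.cons (s a) z : Fin (m + 2) → B)) x := rfl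

theorem prism_sub (s t : A → B) (m : ℕ) (f g : (Fin (m + 1) → B) → V) (x : Fin m → A) :
    prism s t m (fun z => f z - g z) x = prism s t m f x - prism s t m g x := by
  induction m with
  | zero => simp [prism]
  | succ m ih =>
    rw [prism, ih, prism, prism]
    abel

theorem prism_zero (s t : A → B) (m : ℕ) (x : Fin m → A) :
    prism s t m (fun _ => (0 : V)) x = 0 := by
  have h := prism_sub s t m (fun _ => (0 : V)) (fun _ => 0) x
  simpa using h

/-- The chain homotopy `d p + p d = t* - s*`. Induction on the number of variables, applied to `f`
with its first argument frozen at `s a`. -/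
theorem alternatingSum_prism_add (s t : A → B) (m : ℕ) (f : (Fin (m + 1) → B) → V)
    (x : Fin (m + 1) → A) :
    alternatingSum m (prism s t m f) x + prism s t (m + 1) (alternatingSum (m + 1) f) x
      = f (t ∘ x) - f (s ∘ x) := by
  have hcomp : ∀ (l : ℕ) (r : A → B) (a : A) (y : Fin l → A),
      r ∘ (Fin.cons a y : Fin (l + 1) → A) = (Fin.cons (r a) (r ∘ y) : Fin (l + 1) → B) := by
    intro l r a y
    funext k
    refine Fin.cases rfl (fun k => rfl) k
  induction m with
  | zero =>
    obtain ⟨a, y, rfl⟩ : ∃ a y, x = Fin.cons a y := ⟨x 0, Fin.tail x, (Fin.cons_self_tail x).symm⟩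
    rw [prism_cons, alternatingSum_cons, hcomp, hcomp]
    have h1 : alternatingSum 0 (prism s t 0 f) (Fin.cons a y : Fin 1 → A) = 0 := by
      simp [alternatingSum, prism]
    have h2 : ∀ g : (Fin 0 → B) → V, alternatingSum 0 g = fun z => g (fun k => z k.succ) := by
      intro g
      funext z
      simp [alternatingSum]
    rw [h1, h2]
    simp only [prism, zero_add, sub_zero]
    congr 2
    funext k
    refine Fin.cases rfl (fun k => k.elim0) k
  | succ m ih =>
    obtain ⟨a, y, rfl⟩ : ∃ a y, x = Fin.cons a y := ⟨x 0, Fin.tail x, (Fin.cons_self_tail x).symm⟩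
    have h := ih (fun z => f (Fin.cons (s a) z : Fin (m + 2) → B)) y
    rw [alternatingSum_cons, prism_cons, hcomp, hcomp]
    simp only [prism_cons, alternatingSum_cons]
    rw [alternatingSum_sub, prism_sub]
    rw [add_comm, ← eq_sub_iff_add_eq] at h
    have h' := alternatingSum_comp m (fun z : Fin m → B =>
      f (Fin.cons (s a) (Fin.cons (t a) z : Fin (m + 1) → B) : Fin (m + 2) → B)) t y
    rw [h, ← h']
    abel

/-- Equivariance of the homotopy. Two functions `f`, `f'` are needed because the recursion freezes
the first variable at `s a` in one and at `γ' * s a` in the other. -/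
theorem prism_smul [Mul A] [Mul B] (s t : A → B) (γ : A) (γ' : B) (hs : ∀ a, s (γ * a) = γ' * s a)
    (ht : ∀ a, t (γ * a) = γ' * t a) (L : V →+ V) (m : ℕ) (f f' : (Fin (m + 1) → B) → V)
    (hf : ∀ z, f' (fun k => γ' * z k) = L (f z)) (x : Fin m → A) :
    prism s t m f' (fun k => γ * x k) = L (prism s t m f x) := by
  have hcons : ∀ (l : ℕ) (b : B) (z : Fin l → B), (Fin.cons (γ' * b) (fun k => γ' * z k) :
      Fin (l + 1) → B) = fun k => γ' * (Fin.cons b z : Fin (l + 1) → B) k := by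
    intro l b z
    funext k
    refine Fin.cases rfl (fun k => rfl) k
  induction m with
  | zero => simp [prism]
  | succ m ih =>
    rw [prism, prism, map_sub, ← ih _ (fun z => f' (Fin.cons (γ' * s (x 0)) z : Fin (m + 2) → B))
      (fun z => by rw [hcons, hf]), ← hf]
    congr 2
    · rw [← hcons, ← hcons, hs, ht]
      congr 2
      funext k
      exact ht _
    · rw [hs]

end Prism

/-! ### Hecke operators as sums over equivariant functions on the ambient group. -/

section HeckeComposition

variable {𝔽 : Type*} [Field 𝔽] {V : Type*} [AddCommGroup V] [Module 𝔽 V]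
  {G : Type*} [Group G] {S : Submonoid G}

theorem coboundary_eq_alternatingSum {B : Type*} (i : ℕ) (f : (Fin (i + 1) → B) → V) :
    coboundary 𝔽 V B i f = alternatingSum (i + 1) f := by
  funext x
  change ∑ j : Fin (i + 2), (-1 : 𝔽) ^ (j : ℕ) • f (fun k => x (j.succAbove k)) = _
  refine Finset.sum_congr rfl fun j _ => ?_
  rw [← Int.cast_smul_eq_zsmul 𝔽]
  push_cast
  rfl

/-- The `Γ`-equivariant retraction `G → Γ` given by the chosen representatives of `Γ \ G`. -/
def retract (Γ : Subgroup G) (g : G) : Γ :=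
  ⟨g * (coset Γ g).out⁻¹, coset_eq_iff.1 (coset_out _)⟩

theorem retract_mul (Γ : Subgroup G) (γ : Γ) (g : G) : retract Γ (γ * g) = γ * retract Γ g := by
  have h : coset Γ ((γ : G) * g) = coset Γ g := coset_eq_iff.2 (by simp)
  apply Subtype.ext
  simp only [retract, Subgroup.coe_mul, h, mul_assoc]

/-- Hence a Hecke operator on cochains extends `f` to `G` along `retract`, applies `heckeSum`, and
restricts to `Γ'`. -/
theorem cosetCocycle_eq_retract (Γ : Subgroup G) (x : Cosets Γ) (g : G) :
    cosetCocycle Γ x g = retract Γ (x.out * g) := by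
  have h : mulRight Γ g x = coset Γ (x.out * g) := by rw [← mulRight_coset, coset_out]
  apply Subtype.ext
  simp only [cosetCocycle, retract, h]

/-- The functions `f` on `G^m` such that `f (γ g₁, …, γ g_m) = f (g₁, …, g_m) γ⁻¹` for `γ ∈ Γ`. -/
def IsEquivariant (ρ : S →* (Module.End 𝔽 V)ᵐᵒᵖ) (Γ : Subgroup G) {m : ℕ}
    (f : (Fin m → G) → V) : Prop :=
  ∀ γ ∈ Γ, ∀ y : Fin m → G, f (fun k => γ * y k) = act ρ γ⁻¹ (f y)

/-- The operator `f ↦ ∑ aⱼ f (δⱼ g₁, …, δⱼ g_m) δⱼ` on functions on `G^m`. -/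
def heckeSum (ρ : S →* (Module.End 𝔽 V)ᵐᵒᵖ) {Γ : Subgroup G} {m : ℕ} (f : (Fin m → G) → V)
    (y : Fin m → G) : (Cosets Γ →₀ ℤ) →+ V :=
  Finsupp.liftAddHom fun x => zmultiplesHom V (act ρ x.out (f fun k => x.out * y k))

theorem heckeSum_apply (ρ : S →* (Module.End 𝔽 V)ᵐᵒᵖ) {Γ : Subgroup G} {m : ℕ}
    (f : (Fin m → G) → V) (y : Fin m → G) (T : Cosets Γ →₀ ℤ) :
    heckeSum ρ f y T = T.sum fun x a => a • act ρ x.out (f fun k => x.out * y k) := by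
  rfl

/-- By equivariance a summand depends only on the coset, not on its representative. -/
theorem act_coset_out (ρ : S →* (Module.End 𝔽 V)ᵐᵒᵖ) {Γ : Subgroup G} (hΓ : Γ.toSubmonoid ≤ S)
    {m : ℕ} {f : (Fin m → G) → V} (hf : IsEquivariant ρ Γ f) {δ : G} (hδ : δ ∈ S)
    (y : Fin m → G) :
    act ρ (coset Γ δ).out (f fun k => (coset Γ δ).out * y k) = act ρ δ (f fun k => δ * y k) := by
  have hγ : (coset Γ δ).out * δ⁻¹ ∈ Γ := coset_eq_iff.1 (coset_out (coset Γ δ)).symm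
  have h : ∀ k, (coset Γ δ).out * y k = ((coset Γ δ).out * δ⁻¹) * (δ * y k) := fun k => by group
  simp only [h]
  have hout : (coset Γ δ).out ∈ S := by
    have h1 : (coset Γ δ).out = ((coset Γ δ).out * δ⁻¹) * δ := by group
    rw [h1]
    exact S.mul_mem (hΓ hγ) hδ
  rw [hf _ hγ, ← act_mul ρ (hΓ (Γ.inv_mem hγ)) hout]
  congr 2
  group

theorem heckeSum_translate (ρ : S →* (Module.End 𝔽 V)ᵐᵒᵖ) {Γ : Subgroup G}
    (hΓ : Γ.toSubmonoid ≤ S) {m : ℕ} {f : (Fin m → G) → V} (hf : IsEquivariant ρ Γ f)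
    {φ : Cosets Γ →₀ ℤ} (hφ : ∀ x ∈ φ.support, x.out ∈ S) {g : G} (hg : g ∈ S)
    (y : Fin m → G) :
    heckeSum ρ f y (translate Γ g φ) = act ρ g (heckeSum ρ f (fun k => g * y k) φ) := by
  rw [heckeSum_apply, heckeSum_apply, translate, Finsupp.mapDomain.addMonoidHom_apply,
    Finsupp.sum_mapDomain_index (h := fun (x : Cosets Γ) (a : ℤ) => a • act ρ x.out (f fun k => x.out * y k))
      (fun _ => zero_smul _ _) (fun _ _ _ => add_smul _ _ _),
    Finsupp.sum, Finsupp.sum, map_sum]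
  refine Finset.sum_congr rfl fun x hx => ?_
  have h : mulRight Γ g x = coset Γ (x.out * g) := by rw [← mulRight_coset, coset_out]
  rw [map_zsmul, h, act_coset_out ρ hΓ hf (S.mul_mem (hφ x hx) hg), act_mul ρ (hφ x hx) hg]
  simp only [mul_assoc]

theorem heckeSum_isEquivariant (ρ : S →* (Module.End 𝔽 V)ᵐᵒᵖ) {Γ Γ' : Subgroup G} {D : Set G}
    (hΓ : Γ.toSubmonoid ≤ S) (hΓ' : Γ'.toSubmonoid ≤ S) (hD : D ⊆ S) (T : heckeModule Γ Γ' D)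
    {m : ℕ} {f : (Fin m → G) → V} (hf : IsEquivariant ρ Γ f) :
    IsEquivariant ρ Γ' fun y => heckeSum ρ f y (T : Cosets Γ →₀ ℤ) := by
  intro γ hγ y
  have h := heckeSum_translate ρ hΓ hf (φ := (T : Cosets Γ →₀ ℤ))
    (fun x hx => out_mem hΓ hD T hx) (hΓ' hγ) y
  rw [T.2.1 γ hγ] at h
  simp only
  rw [h, ← act_mul ρ (hΓ' hγ) (hΓ' (Γ'.inv_mem hγ)), mul_inv_cancel, act_of_mem ρ S.one_mem]
  have h1 : (⟨1, S.one_mem⟩ : S) = 1 := rfl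
  rw [h1, map_one]
  rfl

/-- For functions on powers of `G` composition holds exactly; the failure on cochains comes only
from restricting to `Γ'` and extending again. -/
theorem heckeSum_compose (ρ : S →* (Module.End 𝔽 V)ᵐᵒᵖ) {Γ Γ' Γ'' : Subgroup G} {D D' : Set G}
    (hΓ : Γ.toSubmonoid ≤ S) (hΓ' : Γ'.toSubmonoid ≤ S) (hD : D ⊆ S) (hD' : D' ⊆ S)
    (φ : heckeModule Γ Γ' D) (ψ : heckeModule Γ' Γ'' D') {m : ℕ} {f : (Fin m → G) → V}
    (hf : IsEquivariant ρ Γ f) (y : Fin m → G) :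
    heckeSum ρ f y (compose φ (ψ : Cosets Γ' →₀ ℤ))
      = heckeSum ρ (fun z => heckeSum ρ f z (φ : Cosets Γ →₀ ℤ)) y (ψ : Cosets Γ' →₀ ℤ) := by
  rw [heckeSum_apply _ _ _ (ψ : Cosets Γ' →₀ ℤ), compose, Finsupp.liftAddHom_apply, Finsupp.sum,
    map_sum, Finsupp.sum]
  refine Finset.sum_congr rfl fun w hw => ?_
  have hw' : transport φ w = translate Γ w.out (φ : Cosets Γ →₀ ℤ) := by
    rw [← transport_coset, coset_out]
  rw [zmultiplesHom_apply, map_zsmul, hw', heckeSum_translate ρ hΓ hf (fun x hx => out_mem hΓ hD φ hx)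
    (out_mem hΓ' hD' ψ hw)]

theorem alternatingSum_heckeSum (ρ : S →* (Module.End 𝔽 V)ᵐᵒᵖ) {Γ : Subgroup G} {m : ℕ}
    (f : (Fin m → G) → V) (T : Cosets Γ →₀ ℤ) (x : Fin (m + 1) → G) :
    alternatingSum m (fun y => heckeSum ρ f y T) x = heckeSum ρ (alternatingSum m f) x T := by
  simp only [heckeSum_apply, alternatingSum, Finsupp.sum, map_sum, map_zsmul, Finset.smul_sum]
  rw [Finset.sum_comm]
  exact Finset.sum_congr rfl fun j _ => Finset.sum_congr rfl fun x _ => smul_comm _ _ _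

theorem heckeCochain_apply (ρ : S →* (Module.End 𝔽 V)ᵐᵒᵖ) {Γ : Subgroup G} (Γ' : Subgroup G)
    (T : Cosets Γ →₀ ℤ) (i : ℕ) (f : (Fin (i + 1) → Γ) → V) (y : Fin (i + 1) → Γ') :
    heckeCochain ρ Γ' T i f y
      = heckeSum ρ (fun z : Fin (i + 1) → G => f (retract Γ ∘ z)) (fun k => (y k : G)) T := by
  rw [heckeSum_apply]
  change T.sum (fun x a => a • act ρ x.out (f fun k => cosetCocycle Γ x (y k : G))) = _
  simp only [cosetCocycle_eq_retract]
  rfl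

theorem isEquivariant_comp_retract (ρ : S →* (Module.End 𝔽 V)ᵐᵒᵖ) {Γ : Subgroup G}
    (hΓ : Γ.toSubmonoid ≤ S) {i : ℕ} {f : (Fin (i + 1) → Γ) → V}
    (hf : f ∈ homCochains (restrictAction ρ Γ hΓ) i) :
    IsEquivariant ρ Γ fun z : Fin (i + 1) → G => f (retract Γ ∘ z) := by
  intro γ hγ y
  have h := hf ⟨γ, hγ⟩ (retract Γ ∘ y)
  rw [restrictAction_apply] at h
  have h1 : (retract Γ ∘ fun k => γ * y k) = fun k => (⟨γ, hγ⟩ : Γ) * (retract Γ ∘ y) k :=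
    funext fun k => retract_mul Γ ⟨γ, hγ⟩ (y k)
  simp only
  rw [h1, h]
  rfl

/-- On cocycles, the operators of a composition and the composition of the operators differ by a
coboundary. -/
theorem heckeCochain_compose (ρ : S →* (Module.End 𝔽 V)ᵐᵒᵖ) {Γ Γ' Γ'' : Subgroup G} {D D' : Set G}
    (hΓ : Γ.toSubmonoid ≤ S) (hΓ' : Γ'.toSubmonoid ≤ S) (hΓ'' : Γ''.toSubmonoid ≤ S) (hD : D ⊆ S)
    (hD' : D' ⊆ S) (φ : heckeModule Γ Γ' D) (ψ : heckeModule Γ' Γ'' D') (i : ℕ)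
    {f : (Fin (i + 1) → Γ) → V} (hf : f ∈ cocycles (restrictAction ρ Γ hΓ) i) :
    heckeCochain ρ Γ'' (compose φ (ψ : Cosets Γ' →₀ ℤ)) i f
      - heckeCochain ρ Γ'' (ψ : Cosets Γ' →₀ ℤ) i (heckeCochain ρ Γ' (φ : Cosets Γ →₀ ℤ) i f)
      ∈ coboundaries (restrictAction ρ Γ'' hΓ'') i := by
  let f₀ : (Fin (i + 1) → G) → V := fun z => f (retract Γ ∘ z)
  have hf₀ : IsEquivariant ρ Γ f₀ := isEquivariant_comp_retract ρ hΓ hf.1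
  have hdf₀ : alternatingSum (i + 1) f₀ = fun _ => 0 := by
    funext z
    have h : coboundary 𝔽 V Γ i f = 0 := hf.2
    rw [coboundary_eq_alternatingSum] at h
    exact congrFun h (retract Γ ∘ z)
  let f₁ : (Fin (i + 1) → G) → V := fun z => heckeSum ρ f₀ z (φ : Cosets Γ →₀ ℤ)
  have hf₁ : IsEquivariant ρ Γ' f₁ := heckeSum_isEquivariant ρ hΓ hΓ' hD φ hf₀
  have hdf₁ : alternatingSum (i + 1) f₁ = fun _ => 0 := by
    funext z
    rw [alternatingSum_heckeSum, hdf₀, heckeSum_apply]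
    simp
  -- Restricting `f₁` to `Γ'` and extending it back replaces it by `f₁ ∘ s`. Both `s` and the
  -- identity are `Γ'`-equivariant, so the prism operator makes the difference the coboundary of an
  -- equivariant `p`, which `ψ` maps to that of `q`.
  let s : G → G := fun g => retract Γ' g
  let p : (Fin i → G) → V := prism s id i f₁
  have hp : IsEquivariant ρ Γ' p := fun γ hγ y =>
    prism_smul s id γ γ (fun a => congrArg Subtype.val (retract_mul Γ' ⟨γ, hγ⟩ a)) (fun _ => rfl)
      (act ρ γ⁻¹).toAddMonoidHom i f₁ f₁ (hf₁ γ hγ) y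
  have hprism : ∀ z, f₁ (s ∘ z) = f₁ z - alternatingSum i p z := fun z => by
    have h := alternatingSum_prism_add s id i f₁ z
    rw [hdf₁, prism_zero, add_zero] at h
    rw [h, Function.id_comp, sub_sub_cancel]
  let q : (Fin i → G) → V := fun z => heckeSum ρ p z (ψ : Cosets Γ' →₀ ℤ)
  have hq : IsEquivariant ρ Γ'' q := heckeSum_isEquivariant ρ hΓ' hΓ'' hD' ψ hp
  have key : ∀ y : Fin (i + 1) → Γ'',
      (heckeCochain ρ Γ'' (compose φ (ψ : Cosets Γ' →₀ ℤ)) i f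
        - heckeCochain ρ Γ'' (ψ : Cosets Γ' →₀ ℤ) i (heckeCochain ρ Γ' (φ : Cosets Γ →₀ ℤ) i f)) y
        = alternatingSum i q (fun k => (y k : G)) := by
    intro y
    rw [Pi.sub_apply, heckeCochain_apply, heckeCochain_apply,
      heckeSum_compose ρ hΓ hΓ' hD hD' φ ψ hf₀, alternatingSum_heckeSum]
    have h : ∀ z : Fin (i + 1) → G,
        heckeCochain ρ Γ' (φ : Cosets Γ →₀ ℤ) i f (retract Γ' ∘ z)
          = f₁ z - alternatingSum i p z := fun z => by
      rw [heckeCochain_apply, ← hprism]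
      rfl
    simp only [h]
    rw [sub_eq_iff_eq_add, heckeSum_apply, heckeSum_apply, heckeSum_apply, ← Finsupp.sum_add]
    refine Finsupp.sum_congr fun x _ => ?_
    rw [← smul_add, ← map_add, add_sub_cancel]
  cases i with
  | zero =>
    -- In degree zero the prism operator vanishes, so the two cochains agree exactly, as
    -- `coboundaries` being `⊥` demands.
    have h0 : heckeCochain ρ Γ'' (compose φ (ψ : Cosets Γ' →₀ ℤ)) 0 f
        - heckeCochain ρ Γ'' (ψ : Cosets Γ' →₀ ℤ) 0 (heckeCochain ρ Γ' (φ : Cosets Γ →₀ ℤ) 0 f)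
        = 0 := by
      funext y
      rw [key]
      simp [alternatingSum, q, p, prism, heckeSum_apply]
    rw [h0]
    exact Submodule.zero_mem _
  | succ i =>
    refine ⟨fun y : Fin (i + 1) → Γ'' => q fun k => (y k : G), fun γ y => ?_, ?_⟩
    · rw [restrictAction_apply]
      exact hq γ γ.2 _
    · funext y
      rw [key, coboundary_eq_alternatingSum]
      rfl

theorem heckeOperator_compose (ρ : S →* (Module.End 𝔽 V)ᵐᵒᵖ) {Γ Γ' Γ'' : Subgroup G}
    {D D' D'' : Set G} (hΓ : Γ.toSubmonoid ≤ S) (hΓ' : Γ'.toSubmonoid ≤ S)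
    (hΓ'' : Γ''.toSubmonoid ≤ S) (hD : D ⊆ S) (hD' : D' ⊆ S) (hD'' : D'' ⊆ S)
    (φ : heckeModule Γ Γ' D) (ψ : heckeModule Γ' Γ'' D') (χ : heckeModule Γ Γ'' D'')
    (hχ : (χ : Cosets Γ →₀ ℤ) = compose φ (ψ : Cosets Γ' →₀ ℤ)) (i : ℕ) :
    heckeOperator ρ hΓ hΓ'' hD'' χ i
      = heckeOperator ρ hΓ' hΓ'' hD' ψ i ∘ₗ heckeOperator ρ hΓ hΓ' hD φ i := by
  refine LinearMap.ext fun c => ?_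
  obtain ⟨f, rfl⟩ := Submodule.Quotient.mk_surjective _ c
  refine (Submodule.Quotient.eq _).2 ?_
  rw [Submodule.submoduleOf, Submodule.mem_comap]
  change heckeCochain ρ Γ'' (χ : Cosets Γ →₀ ℤ) i f.1 - heckeCochain ρ Γ'' (ψ : Cosets Γ' →₀ ℤ) i
    (heckeCochain ρ Γ' (φ : Cosets Γ →₀ ℤ) i f.1) ∈ _
  rw [hχ]
  exact heckeCochain_compose ρ hΓ hΓ' hΓ'' hD hD' φ ψ i f.2

/-- Additivity in sum form serves for two summands, for the sum over classes, and, with an empty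
index set, for the vanishing of the zero operator. -/
theorem heckeOperator_eq_sum (ρ : S →* (Module.End 𝔽 V)ᵐᵒᵖ) {Γ Γ' : Subgroup G} {D : Set G}
    (hΓ : Γ.toSubmonoid ≤ S) (hΓ' : Γ'.toSubmonoid ≤ S) (hD : D ⊆ S) {ι : Type*} (s : Finset ι)
    (χ : heckeModule Γ Γ' D) (φ : ι → heckeModule Γ Γ' D) (h : χ = ∑ j ∈ s, φ j) (i : ℕ) :
    heckeOperator ρ hΓ hΓ' hD χ i = ∑ j ∈ s, heckeOperator ρ hΓ hΓ' hD (φ j) i := by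
  have hadd : ∀ φ ψ : heckeModule Γ Γ' D, heckeOperator ρ hΓ hΓ' hD (φ + ψ) i
      = heckeOperator ρ hΓ hΓ' hD φ i + heckeOperator ρ hΓ hΓ' hD ψ i := by
    intro φ ψ
    refine LinearMap.ext fun c => ?_
    obtain ⟨f, rfl⟩ := Submodule.Quotient.mk_surjective _ c
    refine congrArg (Submodule.Quotient.mk) (Subtype.ext (funext fun y => ?_))
    change heckeCochain ρ Γ' ((φ : Cosets Γ →₀ ℤ) + (ψ : Cosets Γ →₀ ℤ)) i f.1 y
      = heckeCochain ρ Γ' (φ : Cosets Γ →₀ ℤ) i f.1 y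
        + heckeCochain ρ Γ' (ψ : Cosets Γ →₀ ℤ) i f.1 y
    rw [heckeCochain_apply, heckeCochain_apply, heckeCochain_apply, map_add]
  rw [h]
  exact map_sum (AddMonoidHom.mk' (fun φ => heckeOperator ρ hΓ hΓ' hD φ i) hadd) φ s

end HeckeComposition

/-! ### Multiplicativity of the adelic action -/

section Multiplicativity

variable {F : Type*} [Field F] [NumberField F] {n : ℕ}
  {K : Subgroup (GL (Fin n) (AdeleRing (𝓞 F) F))}
  {Δ : Submonoid (GL (Fin n) (AdeleRing (𝓞 F) F))}

theorem localize_apply (hK : K.toSubmonoid ≤ Δ) (a b : GL (Fin n) (AdeleRing (𝓞 F) F))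
    (T : HeckeAlgebra K Δ) (x : Cosets (arithGroup K a)) :
    (localize hK a b T : Cosets (arithGroup K a) →₀ ℤ) x
      = HeckeAlgebra.val T (cosetMap K a b x) := rfl

theorem localize_add (hK : K.toSubmonoid ≤ Δ) (a b : GL (Fin n) (AdeleRing (𝓞 F) F))
    (T T' : HeckeAlgebra K Δ) : localize hK a b (T + T') = localize hK a b T + localize hK a b T' :=
  Subtype.ext (Finsupp.ext fun x => by
    rw [AddSubgroup.coe_add, Finsupp.add_apply, localize_apply, localize_apply, localize_apply,
      map_add, Finsupp.add_apply])

theorem translate_apply_coset {G : Type*} [Group G] (Γ : Subgroup G) (g x : G)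
    (φ : Cosets Γ →₀ ℤ) : translate Γ g φ (coset Γ x) = φ (coset Γ (x * g⁻¹)) := by
  rw [← translate_apply_mulRight Γ g φ, mulRight_coset, inv_mul_cancel_right]

/-- On single cosets both sides evaluate `T` at `K a x y⁻¹ a'⁻¹`: the factors `a''` cancel. -/
theorem compose_mapDomain_cosetMap (hK : K.toSubmonoid ≤ Δ)
    (a a' a'' : GL (Fin n) (AdeleRing (𝓞 F) F)) (T : HeckeAlgebra K Δ)
    (ψ : Cosets (arithGroup K a') →₀ ℤ) (x : Cosets (arithGroup K a)) :
    compose T (Finsupp.mapDomain (cosetMap K a' a'') ψ) (cosetMap K a a'' x)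
      = compose (localize hK a a' T) ψ x := by
  induction ψ using Finsupp.induction_linear with
  | zero => simp
  | add φ ψ h h' =>
    rw [Finsupp.mapDomain_add, map_add, map_add, Finsupp.add_apply, Finsupp.add_apply, h, h']
  | single y m =>
    rw [← coset_out x, ← coset_out y, Finsupp.mapDomain_single, cosetMap_coset, cosetMap_coset,
      HeckeAlgebra.compose_single', compose_single, Finsupp.smul_apply, Finsupp.smul_apply,
      translate_apply_coset, translate_apply_coset, localize_apply, cosetMap_coset]
    congr 3
    rw [map_mul, map_inv]
    group

variable {α : ClassGroup (𝓞 F) → GL (Fin n) (AdeleRing (𝓞 F) F)}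

theorem detClass_eq_of_coset_eq (hK : ∀ κ ∈ K, detClass F n κ = 1)
    {g h : GL (Fin n) (AdeleRing (𝓞 F) F)} (hgh : coset K g = coset K h) :
    detClass F n g = detClass F n h := by
  have h1 := hK _ (coset_eq_iff.1 hgh)
  rw [map_mul, map_inv, mul_inv_eq_one] at h1
  exact h1.symm

theorem exists_cosetMap_eq (hK : IsOpen (K : Set (GL (Fin n) (AdeleRing (𝓞 F) F))))
    (hdet : ∀ a : (AdeleRing (𝓞 F) F)ˣ, ∃ c, ∃ g : GL (Fin n) F, ∃ κ ∈ K,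
      Matrix.GeneralLinearGroup.det (α c * diagonal F n g * κ) = a)
    (b : GL (Fin n) (AdeleRing (𝓞 F) F)) (w : Cosets K) :
    ∃ c, ∃ z, cosetMap K (α c) b z = w := by
  obtain ⟨c, κ, hκ, g, h⟩ := exists_eq_mul_mul_diagonal hK hdet (w.out * b)
  refine ⟨c, coset _ g, ?_⟩
  rw [cosetMap_coset, ← coset_out w, coset_eq_iff]
  have h1 : w.out = κ * (α c * diagonal F n g * b⁻¹) := by
    rw [← mul_assoc, ← mul_assoc, ← h, mul_inv_cancel_right]
  rw [h1, mul_inv_cancel_right]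
  exact hκ

/-- The coset `K α_c g b⁻¹` has determinant class `c` divided by that of `b`, since rational
matrices and `K` contribute trivially. -/
theorem eq_of_cosetMap_eq (hK : ∀ κ ∈ K, detClass F n κ = 1)
    (hα : ∀ c, detClass F n (α c) = c) {b : GL (Fin n) (AdeleRing (𝓞 F) F)}
    {c c' : ClassGroup (𝓞 F)} {z : Cosets (arithGroup K (α c))} {z' : Cosets (arithGroup K (α c'))}
    (h : cosetMap K (α c) b z = cosetMap K (α c') b z') : c = c' := by
  rw [← coset_out z, ← coset_out z', cosetMap_coset, cosetMap_coset] at h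
  have h1 := detClass_eq_of_coset_eq hK h
  simpa [hα, detClass_diagonal] using h1

theorem val_eq_sum_mapDomain_localize (hKΔ : K.toSubmonoid ≤ Δ)
    (hK : IsOpen (K : Set (GL (Fin n) (AdeleRing (𝓞 F) F))))
    (hK' : ∀ κ ∈ K, detClass F n κ = 1) (hα : ∀ c, detClass F n (α c) = c)
    (hdet : ∀ a : (AdeleRing (𝓞 F) F)ˣ, ∃ c, ∃ g : GL (Fin n) F, ∃ κ ∈ K,
      Matrix.GeneralLinearGroup.det (α c * diagonal F n g * κ) = a)
    (b : GL (Fin n) (AdeleRing (𝓞 F) F)) (T : HeckeAlgebra K Δ) :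
    HeckeAlgebra.val T = ∑ c, Finsupp.mapDomain (cosetMap K (α c) b)
      (localize hKΔ (α c) b T : Cosets (arithGroup K (α c)) →₀ ℤ) := by
  ext w
  obtain ⟨c, z, rfl⟩ := exists_cosetMap_eq hK hdet b w
  rw [Finsupp.finsetSum_apply, Finset.sum_eq_single c,
    Finsupp.mapDomain_apply (cosetMap_injective K _ _), localize_apply]
  · intro c' _ hc'
    refine Finsupp.mapDomain_of_notMem_range _ _ ?_
    rintro ⟨z', hz'⟩
    exact hc' (eq_of_cosetMap_eq hK' hα hz')
  · exact fun h => absurd (Finset.mem_univ c) h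

/-- The right factor is split into its localizations at all `α_c`, whose images in the cosets of `K`
are disjoint and exhaustive; the left factor is then compared piece by piece. -/
theorem localize_mul (hKΔ : K.toSubmonoid ≤ Δ)
    (hK : IsOpen (K : Set (GL (Fin n) (AdeleRing (𝓞 F) F))))
    (hK' : ∀ κ ∈ K, detClass F n κ = 1) (hα : ∀ c, detClass F n (α c) = c)
    (hdet : ∀ a : (AdeleRing (𝓞 F) F)ˣ, ∃ c, ∃ g : GL (Fin n) F, ∃ κ ∈ K,
      Matrix.GeneralLinearGroup.det (α c * diagonal F n g * κ) = a)
    (a b : GL (Fin n) (AdeleRing (𝓞 F) F)) (T T' : HeckeAlgebra K Δ) :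
    (localize hKΔ a b (T * T') : Cosets (arithGroup K a) →₀ ℤ)
      = ∑ c, compose (localize hKΔ a (α c) T)
          (localize hKΔ (α c) b T' : Cosets (arithGroup K (α c)) →₀ ℤ) := by
  ext x
  rw [localize_apply, HeckeAlgebra.val_mul,
    val_eq_sum_mapDomain_localize hKΔ hK hK' hα hdet b T', map_sum, Finsupp.finsetSum_apply,
    Finsupp.finsetSum_apply]
  exact Finset.sum_congr rfl fun c _ => compose_mapDomain_cosetMap hKΔ a (α c) b T _ x

variable {𝔽 : Type*} [Field 𝔽] {V : Type*} [AddCommGroup V] [Module 𝔽 V]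
  [hKΔ : IsHeckeTriple Δ K K] {S : Submonoid (GL (Fin n) F)}
  (hS : ∀ c c', arithSet Δ (α c) (α c') ⊆ S) (ρ : S →* (Module.End 𝔽 V)ᵐᵒᵖ) (i : ℕ)

theorem componentOperator_mul
    (hK : IsOpen (K : Set (GL (Fin n) (AdeleRing (𝓞 F) F))))
    (hK' : ∀ κ ∈ K, detClass F n κ = 1) (hα : ∀ c, detClass F n (α c) = c)
    (hdet : ∀ a : (AdeleRing (𝓞 F) F)ˣ, ∃ c, ∃ g : GL (Fin n) F, ∃ κ ∈ K,
      Matrix.GeneralLinearGroup.det (α c * diagonal F n g * κ) = a)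
    (c c'' : ClassGroup (𝓞 F)) (T T' : HeckeAlgebra K Δ) :
    componentOperator K Δ α hS ρ i c c'' (T * T')
      = ∑ c', componentOperator K Δ α hS ρ i c' c'' T'
          ∘ₗ componentOperator K Δ α hS ρ i c c' T := by
  have hmem : ∀ c', ∀ δ ∈ arithSet Δ (α c) (α c'), ∀ δ' ∈ arithSet Δ (α c') (α c''),
      δ * δ' ∈ arithSet Δ (α c) (α c'') := by
    intro c' δ hδ δ' hδ'
    have h := Δ.mul_mem hδ hδ'
    have h1 : α c * diagonal F n δ * (α c')⁻¹ * (α c' * diagonal F n δ' * (α c'')⁻¹)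
        = α c * diagonal F n (δ * δ') * (α c'')⁻¹ := by
      rw [map_mul]
      group
    rw [h1] at h
    exact h
  rw [componentOperator, heckeOperator_eq_sum ρ _ _ _ Finset.univ _
    (fun c' => ⟨_, compose_mem (localize hKΔ.left_le (α c) (α c') T)
      (localize hKΔ.left_le (α c') (α c'') T') (hmem c')⟩)]
  · exact Finset.sum_congr rfl fun c' _ => heckeOperator_compose ρ _ _ _ _ _ _ _ _ _ rfl i
  · apply Subtype.ext
    rw [localize_mul hKΔ.left_le hK hK' hα hdet, AddSubgroup.val_finsetSum]

theorem componentOperator_add (c c' : ClassGroup (𝓞 F)) (T T' : HeckeAlgebra K Δ) :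
    componentOperator K Δ α hS ρ i c c' (T + T')
      = componentOperator K Δ α hS ρ i c c' T + componentOperator K Δ α hS ρ i c c' T' := by
  have h := heckeOperator_eq_sum ρ (arithGroup_le hKΔ.left_le (hS c c))
    (arithGroup_le hKΔ.left_le (hS c' c')) (hS c c') (Finset.univ : Finset (Fin 2)) _
    ![localize hKΔ.left_le (α c) (α c') T, localize hKΔ.left_le (α c) (α c') T']
    (localize_add hKΔ.left_le (α c) (α c') T T' |>.trans (by simp)) i
  rw [Fin.sum_univ_two] at h
  exact h

theorem adelicOperator_mul
    (hK : IsOpen (K : Set (GL (Fin n) (AdeleRing (𝓞 F) F))))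
    (hK' : ∀ κ ∈ K, detClass F n κ = 1) (hα : ∀ c, detClass F n (α c) = c)
    (hdet : ∀ a : (AdeleRing (𝓞 F) F)ˣ, ∃ c, ∃ g : GL (Fin n) F, ∃ κ ∈ K,
      Matrix.GeneralLinearGroup.det (α c * diagonal F n g * κ) = a)
    (T T' : HeckeAlgebra K Δ) :
    adelicOperator K Δ α hS ρ i (T * T')
      = adelicOperator K Δ α hS ρ i T' ∘ₗ adelicOperator K Δ α hS ρ i T := by
  refine LinearMap.ext fun f => funext fun c'' => ?_
  simp only [adelicOperator, componentOperator_mul hS ρ i hK hK' hα hdet, LinearMap.pi_apply,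
    LinearMap.comp_apply, LinearMap.sum_apply, LinearMap.proj_apply, map_sum]
  exact Finset.sum_comm

theorem adelicOperator_add (T T' : HeckeAlgebra K Δ) :
    adelicOperator K Δ α hS ρ i (T + T')
      = adelicOperator K Δ α hS ρ i T + adelicOperator K Δ α hS ρ i T' := by
  refine LinearMap.ext fun f => funext fun c'' => ?_
  simp only [adelicOperator, componentOperator_add, LinearMap.pi_apply,
    LinearMap.comp_apply, LinearMap.sum_apply, LinearMap.proj_apply, LinearMap.add_apply,
    Pi.add_apply, Finset.sum_add_distrib]

end Multiplicativity

/-! ### Eigenvectors of graded commutative rings -/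

section GradedEigenvector

variable {R C 𝔽 : Type*} [Ring R] [CommGroup C] [Finite C] [Field 𝔽] {𝒜 : C → Set R}

/-- In a finite group `d⁻¹` is a power of `d`, so a power of `x` will do. Consequently the degrees
where `Ψ` is nonzero form a subgroup. -/
theorem exists_mem_inv_map_ne_zero (one_mem : 1 ∈ 𝒜 1)
    (mul_mem : ∀ d e, ∀ x ∈ 𝒜 d, ∀ y ∈ 𝒜 e, x * y ∈ 𝒜 (d * e)) (Ψ : R →+* 𝔽) {d : C} {x : R}
    (hx : x ∈ 𝒜 d) (hΨ : Ψ x ≠ 0) : ∃ y ∈ 𝒜 d⁻¹, Ψ y ≠ 0 := by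
  have hpow : ∀ k : ℕ, x ^ k ∈ 𝒜 (d ^ k) := by
    intro k
    induction k with
    | zero => simpa using one_mem
    | succ k ih =>
      rw [pow_succ, pow_succ]
      exact mul_mem _ _ _ ih _ hx
  refine ⟨x ^ (orderOf d - 1), ?_, by simpa using pow_ne_zero _ hΨ⟩
  have h : d ^ (orderOf d - 1) = d⁻¹ := by
    rw [eq_inv_iff_mul_eq_one, ← pow_succ, Nat.sub_add_cancel (orderOf_pos d), pow_orderOf_eq_one]
  exact h ▸ hpow _

variable {M : C → Type*} [∀ c, AddCommGroup (M c)] [∀ c, Module 𝔽 (M c)]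
  {op : R → (∀ c, M c) →ₗ[𝔽] ∀ c, M c} {Ψ : R →+* 𝔽}

theorem exists_eigenvector_forall_apply_eq_zero (hcomm : ∀ x y : R, x * y = y * x)
    (one_mem : 1 ∈ 𝒜 1) (mul_mem : ∀ d e, ∀ x ∈ 𝒜 d, ∀ y ∈ 𝒜 e, x * y ∈ 𝒜 (d * e))
    (op_mul : ∀ x y, op (x * y) = op y ∘ₗ op x)
    (op_mem : ∀ d, ∀ x ∈ 𝒜 d, ∀ (c : C) (f : ∀ c, M c), (∀ c' ≠ c, f c' = 0) →
      ∀ c' ≠ d⁻¹ * c, op x f c' = 0)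
    {c : C} {f : ∀ c, M c} (hf0 : f ≠ 0) (hfc : ∀ c' ≠ c, f c' = 0)
    (hf : ∀ x ∈ 𝒜 1, op x f = Ψ x • f) :
    ∃ (c : C) (f : ∀ c, M c), f ≠ 0 ∧ (∀ c' ≠ c, f c' = 0) ∧ (∀ x ∈ 𝒜 1, op x f = Ψ x • f) ∧
      ∀ d, (∀ x ∈ 𝒜 d, Ψ x = 0) → ∀ x ∈ 𝒜 d, op x f = 0 := by
  -- Strong induction on the number of degrees acting nontrivially on `f`.
  let N : (∀ c, M c) → Set C := fun f => {d | ∃ x ∈ 𝒜 d, op x f ≠ 0}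
  have hone : ∀ f : (∀ c, M c), f ≠ 0 → (∀ x ∈ 𝒜 1, op x f = Ψ x • f) → (1 : C) ∈ N f :=
    fun f hf0 hf => ⟨1, one_mem, by rwa [hf 1 one_mem, map_one, one_smul]⟩
  induction hk : (N f).ncard using Nat.strong_induction_on generalizing f c with
  | _ k ih =>
    by_cases hkill : ∀ d, (∀ x ∈ 𝒜 d, Ψ x = 0) → ∀ x ∈ 𝒜 d, op x f = 0
    · exact ⟨c, f, hf0, hfc, hf, hkill⟩
    · push Not at hkill
      obtain ⟨d, hd, x, hx, hxf⟩ := hkill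
      refine ih (N (op x f)).ncard ?_ hxf (op_mem d x hx c f hfc) (fun y hy => ?_) rfl
      -- The translate `d · N(f | x)` lies in `N f` but misses `1`: if `d e = 1`, then `x y` has
      -- degree one and acts on `f` by `Ψ x Ψ y = 0`.
      · rw [← hk, ← Set.ncard_image_of_injective _ (mul_right_injective d)]
        refine Set.ncard_lt_ncard (Set.ssubset_iff_exists.2 ⟨?_, 1, hone f hf0 hf, ?_⟩)
          (Set.toFinite _)
        · rintro _ ⟨e, ⟨y, hy, hyf⟩, rfl⟩
          exact ⟨x * y, mul_mem d e x hx y hy, by rwa [op_mul]⟩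
        · rintro ⟨e, ⟨y, hy, hyf⟩, he⟩
          have hxy : x * y ∈ 𝒜 1 := by
            have h := mul_mem d e x hx y hy
            rwa [show d * e = 1 from he] at h
          apply hyf
          rw [← LinearMap.comp_apply, ← op_mul, hf _ hxy, map_mul, hd x hx, zero_mul, zero_smul]
      · rw [← LinearMap.comp_apply, ← op_mul, hcomm, op_mul, LinearMap.comp_apply, hf y hy,
          map_smul]

/-- If the degree one part of a commutative ring graded by a finite group acts on a homogeneous
vector through a character of the whole ring, then the character occurs in the space. -/
theorem occurs_of_homogeneous_eigenvector (hcomm : ∀ x y : R, x * y = y * x)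
    (one_mem : 1 ∈ 𝒜 1) (mul_mem : ∀ d e, ∀ x ∈ 𝒜 d, ∀ y ∈ 𝒜 e, x * y ∈ 𝒜 (d * e))
    (hsum : ∀ s : Set R, (∀ d, 𝒜 d ⊆ s) → (∀ x ∈ s, ∀ y ∈ s, x + y ∈ s) → s = Set.univ)
    (op_mul : ∀ x y, op (x * y) = op y ∘ₗ op x) (op_add : ∀ x y, op (x + y) = op x + op y)
    (op_mem : ∀ d, ∀ x ∈ 𝒜 d, ∀ (c : C) (f : ∀ c, M c), (∀ c' ≠ c, f c' = 0) →
      ∀ c' ≠ d⁻¹ * c, op x f c' = 0)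
    {c : C} {f : ∀ c, M c} (hf0 : f ≠ 0) (hfc : ∀ c' ≠ c, f c' = 0)
    (hf : ∀ x ∈ 𝒜 1, op x f = Ψ x • f) : Occurs op Ψ := by
  classical
  have := Fintype.ofFinite C
  obtain ⟨c, f, hf0, hfc, hf, hkill⟩ := exists_eigenvector_forall_apply_eq_zero hcomm one_mem
    mul_mem op_mul op_mem hf0 hfc hf
  have op_op : ∀ x y, op y (op x f) = op (x * y) f := fun x y => by
    rw [op_mul, LinearMap.comp_apply]
  -- The images of `f` under `x` and `y` are compared after multiplying by some `z` of inverse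
  -- degree with `Ψ z ≠ 0`: both `z y` and `z x` act on `f` by scalars, and `z y x = z x y`.
  have key : ∀ d, ∀ x ∈ 𝒜 d, ∀ y ∈ 𝒜 d, Ψ y ≠ 0 → op x f = Ψ x • (Ψ y)⁻¹ • op y f := by
    intro d x hx y hy hΨ
    obtain ⟨z, hz, hzΨ⟩ := exists_mem_inv_map_ne_zero one_mem mul_mem Ψ hy hΨ
    have hz1 : ∀ w ∈ 𝒜 d, z * w ∈ 𝒜 1 := fun w hw => by
      have h := mul_mem _ _ z hz w hw
      rwa [inv_mul_cancel] at h
    have h1 : (Ψ z * Ψ y) • op x f = op (z * y * x) f := by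
      rw [← op_op, hf _ (hz1 y hy), map_smul, map_mul]
    have h2 : (Ψ z * Ψ x) • op y f = op (z * x * y) f := by
      rw [← op_op, hf _ (hz1 x hx), map_smul, map_mul]
    rw [mul_assoc, hcomm y x, ← mul_assoc, ← h2, mul_smul, mul_smul] at h1
    have h3 := smul_right_injective _ hzΨ h1
    rw [smul_comm, ← h3, smul_smul, inv_mul_cancel₀ hΨ, one_smul]
  have hu : ∀ d, ∃ u : ∀ c, M c, (∀ x ∈ 𝒜 d, op x f = Ψ x • u) ∧
      ((∀ x ∈ 𝒜 d, Ψ x = 0) ∧ u = 0 ∨ ∃ y ∈ 𝒜 d, Ψ y ≠ 0 ∧ u = (Ψ y)⁻¹ • op y f) := by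
    intro d
    by_cases h : ∀ x ∈ 𝒜 d, Ψ x = 0
    · exact ⟨0, fun x hx => by rw [hkill d h x hx, smul_zero], Or.inl ⟨h, rfl⟩⟩
    · push Not at h
      obtain ⟨y, hy, hΨ⟩ := h
      exact ⟨_, fun x hx => key d x hx y hy hΨ, Or.inr ⟨y, hy, hΨ, rfl⟩⟩
  choose u hu hu' using hu
  -- If `Ψ` vanishes in degree `d` but not in degree `d e`, then it vanishes in degree `e` as well,
  -- so both sides are zero.
  have hop : ∀ e, ∀ x ∈ 𝒜 e, ∀ d, op x (u d) = Ψ x • u (d * e) := by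
    intro e x hx d
    rcases hu' d with ⟨h0, h⟩ | ⟨y, hy, hΨ, h⟩
    · rw [h, map_zero]
      rcases hu' (d * e) with ⟨_, h⟩ | ⟨y, hy, hΨ, _⟩
      · rw [h, smul_zero]
      · by_cases hx0 : Ψ x = 0
        · rw [hx0, zero_smul]
        · obtain ⟨z, hz, hzΨ⟩ := exists_mem_inv_map_ne_zero one_mem mul_mem Ψ hx hx0
          have hyz := mul_mem _ _ y hy z hz
          rw [mul_inv_cancel_right] at hyz
          have h1 := h0 _ hyz
          rw [map_mul] at h1
          exact absurd h1 (mul_ne_zero hΨ hzΨ)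
    · rw [h, map_smul, op_op, hu (d * e) _ (mul_mem _ _ y hy x hx), map_mul, smul_smul, ← mul_assoc,
        inv_mul_cancel₀ hΨ, one_mul]
  have huc : ∀ d, ∀ c' ≠ d⁻¹ * c, u d c' = 0 := by
    intro d c' hc'
    rcases hu' d with ⟨_, h⟩ | ⟨y, hy, _, h⟩
    · rw [h, Pi.zero_apply]
    · rw [h, Pi.smul_apply, op_mem d y hy c f hfc c' hc', smul_zero]
  have hu1 : u 1 = f := by
    have h := hu 1 1 one_mem
    rwa [hf 1 one_mem, map_one, one_smul, one_smul, eq_comm] at h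
  refine ⟨∑ d, u d, fun h => hf0 ?_, ?_⟩
  · have hc : f c = 0 := by
      have h1 := congrFun h c
      rw [Finset.sum_apply, Finset.sum_eq_single 1, hu1] at h1
      · exact h1
      · exact fun d _ hd => huc d c fun h2 => hd (by simpa using h2)
      · exact fun h2 => absurd (Finset.mem_univ _) h2
    funext c'
    by_cases hcc : c' = c
    · rw [hcc, hc, Pi.zero_apply]
    · exact hfc c' hcc
  · refine Set.eq_univ_iff_forall.1 (hsum {x | op x (∑ d, u d) = Ψ x • ∑ d, u d} ?_ ?_)
    · intro e x hx
      change op x (∑ d, u d) = Ψ x • ∑ d, u d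
      rw [map_sum, Finset.sum_congr rfl fun d _ => hop e x hx d, ← Finset.smul_sum]
      congr 1
      -- Right translation by `e` only permutes the summands.
      exact Equiv.sum_comp (Equiv.mulRight e) u
    · intro x hx y hy
      change op (x + y) (∑ d, u d) = Ψ (x + y) • ∑ d, u d
      rw [op_add, LinearMap.add_apply, show op x _ = _ from hx, show op y _ = _ from hy, map_add,
        add_smul]

end GradedEigenvector

/-! ### The grading of the Hecke algebra by ideal classes -/

section ClassGrading

variable {F : Type*} [Field F] [NumberField F] {n : ℕ}
  (K : Subgroup (GL (Fin n) (AdeleRing (𝓞 F) F)))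
  (Δ : Submonoid (GL (Fin n) (AdeleRing (𝓞 F) F)))

/-- The elements of `R(K, Δ)` supported on the `δ ∈ Δ` for which `(det δ)` lies in the class `d`. -/
def classPart (d : ClassGroup (𝓞 F)) : Set (HeckeAlgebra K Δ) :=
  {T | HeckeAlgebra.val T ∈ heckeModule K K ((Δ : Set _) ∩ detClass F n ⁻¹' {d})}

variable {K Δ}

theorem one_mem_classPart : 1 ∈ classPart K Δ 1 :=
  ⟨fun _ hk => HeckeAlgebra.val_translate 1 hk, fun x hx => ⟨1, ⟨Δ.one_mem, map_one _⟩, by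
    by_contra h
    exact hx (Finsupp.single_eq_of_ne h)⟩⟩

theorem mul_mem_classPart (d e : ClassGroup (𝓞 F)) (T : HeckeAlgebra K Δ)
    (hT : T ∈ classPart K Δ d) (T' : HeckeAlgebra K Δ) (hT' : T' ∈ classPart K Δ e) :
    T * T' ∈ classPart K Δ (d * e) :=
  compose_mem (⟨_, hT⟩ : heckeModule K K ((Δ : Set _) ∩ detClass F n ⁻¹' {d}))
    (⟨_, hT'⟩ : heckeModule K K ((Δ : Set _) ∩ detClass F n ⁻¹' {e}))
    fun δ hδ δ' hδ' => ⟨Δ.mul_mem hδ.1 hδ'.1, by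
      rw [Set.mem_preimage, map_mul, show detClass F n δ = d from hδ.2,
        show detClass F n δ' = e from hδ'.2]
      rfl⟩

/-- Cutting `T` off to one determinant class keeps it right `K`-invariant, because right
multiplication by `K` does not change the class. -/
theorem exists_sum_classPart (hK : ∀ κ ∈ K, detClass F n κ = 1) (T : HeckeAlgebra K Δ) :
    ∃ t : ClassGroup (𝓞 F) → HeckeAlgebra K Δ, (∀ d, t d ∈ classPart K Δ d) ∧ T = ∑ d, t d := by
  classical
  let φ : ClassGroup (𝓞 F) → (Cosets K →₀ ℤ) := fun d =>
    (HeckeAlgebra.val T).filter fun x => detClass F n x.out = d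
  have hφ : ∀ d, φ d ∈ heckeModule K K ((Δ : Set _) ∩ detClass F n ⁻¹' {d}) := by
    intro d
    refine ⟨fun k hk => Finsupp.ext fun y => ?_, fun x hx => ?_⟩
    · have hy : y = mulRight K k (mulRight K k⁻¹ y) := by
        rw [mulRight_mul, inv_mul_cancel, mulRight_one]
      generalize mulRight K k⁻¹ y = x at hy
      subst hy
      have h : detClass F n (mulRight K k x).out = detClass F n x.out := by
        rw [detClass_eq_of_coset_eq hK (g := (mulRight K k x).out) (h := x.out * k)
          (by rw [coset_out, ← mulRight_coset, coset_out]), map_mul, hK k hk, mul_one]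
      rw [translate_apply_mulRight, Finsupp.filter_apply, Finsupp.filter_apply, h]
      conv_rhs => rw [← HeckeAlgebra.val_translate T hk, translate_apply_mulRight]
    · rw [Finsupp.filter_apply] at hx
      split_ifs at hx with hd
      · obtain ⟨δ, hδ, h⟩ := T.exists_of_val_ne_zero hx
        exact ⟨δ, ⟨hδ, (detClass_eq_of_coset_eq hK (by rw [← h, coset_out])).symm.trans hd⟩, h⟩
      · exact absurd rfl hx
  have ht : ∀ d, ∃ t : HeckeAlgebra K Δ, HeckeAlgebra.val t = φ d := fun d =>
    ⟨⟨φ d, (hφ d).1, fun x hx => by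
      obtain ⟨δ, hδ, h⟩ := (hφ d).2 x hx
      exact ⟨δ, hδ.1, h⟩⟩, rfl⟩
  choose t ht using ht
  refine ⟨t, fun d => ?_, HeckeAlgebra.val_injective ?_⟩
  · rw [classPart, Set.mem_ofPred_eq, ht]
    exact hφ d
  · rw [map_sum, Finset.sum_congr rfl fun d _ => ht d]
    ext x
    rw [Finsupp.finsetSum_apply]
    simp only [Finsupp.filter_apply, Finset.sum_ite_eq, Finset.mem_univ, if_true]

theorem exists_inclusion_eq {T : HeckeAlgebra K Δ} (hT : T ∈ classPart K Δ 1) :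
    ∃ T' : HeckeAlgebra K (principalPart Δ), HeckeAlgebra.inclusion inf_le_left T' = T :=
  ⟨⟨HeckeAlgebra.val T, hT⟩, rfl⟩

/-- Cosets `K a g b⁻¹` have the class of `a` divided by that of `b`, so they avoid the support of
`T` unless this quotient is `d`. -/
theorem localize_eq_zero (hKΔ : K.toSubmonoid ≤ Δ) (hK : ∀ κ ∈ K, detClass F n κ = 1)
    {d : ClassGroup (𝓞 F)} {T : HeckeAlgebra K Δ} (hT : T ∈ classPart K Δ d)
    {a b : GL (Fin n) (AdeleRing (𝓞 F) F)} (hab : detClass F n a ≠ d * detClass F n b) :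
    localize hKΔ a b T = 0 := by
  refine Subtype.ext (Finsupp.ext fun x => ?_)
  rw [localize_apply]
  by_contra h
  obtain ⟨δ, hδ, hx⟩ := hT.2 _ h
  rw [← coset_out x, cosetMap_coset] at hx
  have h1 := detClass_eq_of_coset_eq hK hx
  rw [show detClass F n δ = d from hδ.2, map_mul, map_mul, detClass_diagonal, mul_one, map_inv,
    mul_inv_eq_iff_eq_mul] at h1
  exact hab h1

variable {α : ClassGroup (𝓞 F) → GL (Fin n) (AdeleRing (𝓞 F) F)}
  {𝔽 : Type*} [Field 𝔽] {V : Type*} [AddCommGroup V] [Module 𝔽 V]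
  [hKΔ : IsHeckeTriple Δ K K] {S : Submonoid (GL (Fin n) F)}
  (hS : ∀ c c', arithSet Δ (α c) (α c') ⊆ S) (ρ : S →* (Module.End 𝔽 V)ᵐᵒᵖ) (i : ℕ)

theorem componentOperator_eq_zero (hK : ∀ κ ∈ K, detClass F n κ = 1)
    (hα : ∀ c, detClass F n (α c) = c) {d : ClassGroup (𝓞 F)} {T : HeckeAlgebra K Δ}
    (hT : T ∈ classPart K Δ d) {c c' : ClassGroup (𝓞 F)} (hc : c ≠ d * c') :
    componentOperator K Δ α hS ρ i c c' T = 0 := by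
  have h := localize_eq_zero hKΔ.left_le hK hT (a := α c) (b := α c') (by rwa [hα, hα])
  rw [componentOperator, heckeOperator_eq_sum ρ _ _ _ (∅ : Finset Empty) _ (fun _ => 0)
    (h.trans Finset.sum_empty.symm), Finset.sum_empty]

theorem adelicOperator_apply_eq_zero (hK : ∀ κ ∈ K, detClass F n κ = 1)
    (hα : ∀ c, detClass F n (α c) = c) (d : ClassGroup (𝓞 F)) (T : HeckeAlgebra K Δ)
    (hT : T ∈ classPart K Δ d) (c : ClassGroup (𝓞 F)) (f : TotalCohomology K Δ α hS ρ i)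
    (hf : ∀ c' ≠ c, f c' = 0) (c' : ClassGroup (𝓞 F)) (hc' : c' ≠ d⁻¹ * c) :
    adelicOperator K Δ α hS ρ i T f c' = 0 := by
  simp only [adelicOperator, LinearMap.pi_apply, LinearMap.sum_apply, LinearMap.comp_apply,
    LinearMap.proj_apply]
  refine Finset.sum_eq_zero fun e _ => ?_
  by_cases he : e = c
  · rw [componentOperator_eq_zero hS ρ i hK hα hT, LinearMap.zero_apply]
    rintro rfl
    exact hc' (by rw [← he, inv_mul_cancel_left])
  · rw [hf e he, map_zero]

theorem adelicOperator_single (T : HeckeAlgebra K Δ) (c c' : ClassGroup (𝓞 F))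
    (f : CohomologyAt K Δ α hS ρ i c) [DecidableEq (ClassGroup (𝓞 F))] :
    adelicOperator K Δ α hS ρ i T (Pi.single c f) c' = componentOperator K Δ α hS ρ i c c' T f := by
  simp only [adelicOperator, LinearMap.pi_apply, LinearMap.sum_apply, LinearMap.comp_apply,
    LinearMap.proj_apply]
  rw [Finset.sum_eq_single c, Pi.single_eq_same]
  · intro e _ he
    rw [Pi.single_eq_of_ne he, map_zero]
  · exact fun h => absurd (Finset.mem_univ c) h

end ClassGrading
end AdelicHecke

end

theorem mainTheorem7
    {F : Type*} [Field F] [NumberField F] {n : ℕ}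
    {𝔽 : Type*} [Field 𝔽]
    (K : Subgroup (GL (Fin n) (AdeleRing (𝓞 F) F)))
    (Δ : Submonoid (GL (Fin n) (AdeleRing (𝓞 F) F)))
    [IsHeckeTriple Δ K K]
    (hK_open : IsOpen (K : Set (GL (Fin n) (AdeleRing (𝓞 F) F))))
    (hK_principal : ∀ κ ∈ K, AdelicHecke.detClass F n κ = 1)
    (α : ClassGroup (𝓞 F) → GL (Fin n) (AdeleRing (𝓞 F) F))
    (hα : ∀ c, AdelicHecke.detClass F n (α c) = c)
    (hdet : ∀ a : (AdeleRing (𝓞 F) F)ˣ, ∃ c, ∃ g : GL (Fin n) F, ∃ κ ∈ K,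
      Matrix.GeneralLinearGroup.det (α c * AdelicHecke.diagonal F n g * κ) = a)
    (hcomm : ∀ T T' : AdelicHecke.HeckeAlgebra K Δ, T * T' = T' * T)
    {V : Type*} [AddCommGroup V] [Module 𝔽 V]
    (S : Submonoid (GL (Fin n) F))
    (hS : ∀ c c', AdelicHecke.arithSet Δ (α c) (α c') ⊆ S)
    (ρ : S →* (Module.End 𝔽 V)ᵐᵒᵖ) (i : ℕ)
    (Ψ : AdelicHecke.HeckeAlgebra K Δ →+* 𝔽)
    (c' : ClassGroup (𝓞 F))
    (hΨ : AdelicHecke.Occurs (AdelicHecke.principalOperator K Δ α hS ρ i c')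
      (Ψ.comp (AdelicHecke.HeckeAlgebra.inclusion
        (inf_le_left : AdelicHecke.principalPart Δ ≤ Δ)))) :
    AdelicHecke.Occurs (AdelicHecke.adelicOperator K Δ α hS ρ i) Ψ := by
  classical
  obtain ⟨f, hf0, hf⟩ := hΨ
  refine AdelicHecke.occurs_of_homogeneous_eigenvector (𝒜 := AdelicHecke.classPart K Δ)
    (c := c') (f := Pi.single c' f) hcomm AdelicHecke.one_mem_classPart
    AdelicHecke.mul_mem_classPart (fun s hs hadd => Set.eq_univ_of_forall fun T => ?_)
    (AdelicHecke.adelicOperator_mul hS ρ i hK_open hK_principal hα hdet)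
    (AdelicHecke.adelicOperator_add hS ρ i)
    (AdelicHecke.adelicOperator_apply_eq_zero hS ρ i hK_principal hα)
    (fun h => hf0 (by simpa using congrFun h c')) (fun c hc => Pi.single_eq_of_ne hc f)
    fun T hT => funext fun c => ?_
  · obtain ⟨t, ht, rfl⟩ := AdelicHecke.exists_sum_classPart hK_principal T
    -- The sum over classes is nonempty, so closure of `s` under addition is enough.
    exact Finset.sum_induction_nonempty t (· ∈ s) (fun x y hx hy => hadd x hx y hy)
      Finset.univ_nonempty fun d _ => hs d (ht d)
  · rw [AdelicHecke.adelicOperator_single, Pi.smul_apply]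
    by_cases hc : c = c'
    · subst hc
      obtain ⟨T', rfl⟩ := AdelicHecke.exists_inclusion_eq hT
      rw [Pi.single_eq_same]
      exact hf T'
    -- An element of degree one preserves each component, so nothing appears away from `c'`.
    · rw [AdelicHecke.componentOperator_eq_zero hS ρ i hK_principal hα hT
        (by rw [one_mul]; exact Ne.symm hc), LinearMap.zero_apply, Pi.single_eq_of_ne hc, smul_zero]
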